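/- Let $p$ be an odd prime, $\mathbb{A}\in\{\mathbb{F}_p,\mathbb{Z}_p\}$, let $q$ be a prime dividing $p-1$, let $G$ be a finitely generated pro-$p$ group and $\Delta\subset \mathrm{Aut}(G)$ a cyclic subgroup of order $q$. Let $\mathrm{Irr}(\Delta)=\mathrm{Hom}(\Delta,\mathbb{Z}_p^\times)$ (a group of order $q$; its elements act on $\mathbb{A}$-modules through $\mathbb{Z}_p\to\mathbb{A}$) and, for an $\mathbb{A}[\Delta]$-module $M$, put $M[\chi]=\{m\in M:\ \delta(m)=\chi(\delta)m\ \ \forall\delta\in\Delta\}$. Let $Al(\mathbb{A},G)=\varprojlim_U \mathbb{A}[G/U]$ ($U$ running over the open normal subgroups of $G$) be the completed group algebra, $Al_n(\mathbb{A},G)$ the $n$-th power of its augmentation ideal, $G_n=\{g\in G: g-1\in Al_n(\mathbb{A},G)\}$, $\mathcal{E}_n=Al_n(\mathbb{A},G)/Al_{n+1}(\mathbb{A},G)$ and $\mathcal{L}_n=G_n/G_{n+1}$. For $\chi\in\mathrm{Irr}(\Delta)$ put $c_n^\chi=\mathrm{rank}_{\mathbb{A}}\,\mathcal{E}_n[\chi]$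 and $a_n^\chi=\mathrm{rank}_{\mathbb{A}}\,\mathcal{L}_n[\chi]$. Let $1\to R\to F\to G\to 1$ be a minimal presentation of $G$, where $F$ is the free pro-$p$ group on a finite family $(x_j^\chi)_{\chi\in\mathrm{Irr}(\Delta),\,1\le j\le d^\chi}$ such that, for each $\chi$, the images of $x^\chi_1,\dots,x^\chi_{d^\chi}$ form an $\mathbb{A}$-basis of $\mathcal{L}_1[\chi]$ and such that $\Delta$ acts diagonally, that is, $\delta(x_j^\chi)=(x_j^\chi)^{\chi(\delta)}$ in $G$ for all $\delta\in\Delta$. Identify $Al(\mathbb{A},F)$ with the algebra of noncommutative power series $\mathbb{A}\langle\langle X_j^\chi\rangle\rangle$ by $x_j^\chi\mapsto 1+X_j^\chi$. Fix a non-trivial $\chi_0\in\mathrm{Irr}(\Delta)$ and, for $\chi\in\mathrm{Irr}(\Delta)$, let $\psi(\chi)\in\{1,\dots,q\}$ be the integer with $\chi=\chi_0^{\psi(\chi)}$. Let $E_{\chi_0,n}(\mathbb{A})\subset \mathbb{A}\langle\langle X_j^\chi\rangle\rangle$ be the set of series all of whose monomials have degree at least $n$, where $X_j^\chi$ has degree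 $\psi(\chi)$; let $I$ be the two-sided ideal generated by the elements $r-1$ with $r\in R$, and let $E_{\chi_0,n}(\mathbb{A},G)$ be the image of $E_{\chi_0,n}(\mathbb{A})$ in the quotient $\mathbb{A}\langle\langle X_j^\chi\rangle\rangle/I$. Put $G_{\chi_0,n}=\{g\in G: g-1\in E_{\chi_0,n}(\mathbb{A},G)\}$, $\mathcal{L}_{\chi_0,n}=G_{\chi_0,n}/G_{\chi_0,n+1}$, $$c_{\chi_0,n}=\mathrm{rank}_{\mathbb{A}}\,E_{\chi_0,n}(\mathbb{A},G)/E_{\chi_0,n+1}(\mathbb{A},G),\qquad a_{\chi_0,n}=\mathrm{rank}_{\mathbb{A}}\,\mathcal{L}_{\chi_0,n}.$$ Assume that $\bigoplus_n\mathcal{L}_n$ and $\bigoplus_n\mathcal{L}_{\chi_0,n}$ are torsion-free over $\mathbb{A}$. Then, for all integers $n,i\ge 0$, $$c_{\chi_0,qn+i}\le\sum_{j=n}^{qn+i}c_j^{\chi_0^i},\qquad a_{\chi_0,qn+i}\le\sum_{j=n}^{qn+i}a_j^{\chi_0^i},$$ and, for all $n\ge 0$ and all $\chi\in\mathrm{Irr}(\Delta)$,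 $$c_n^\chi\le\sum_{k=\lceil (n-\psi(\chi))/q\rceil}^{\lfloor n-\psi(\chi)/q\rfloor}c_{\chi_0,qk+\psi(\chi)},\qquad a_n^\chi\le\sum_{k=\lceil (n-\psi(\chi))/q\rceil}^{\lfloor n-\psi(\chi)/q\rfloor}a_{\chi_0,qk+\psi(\chi)}.$$ -/

import Mathlib

open Filter Topology

noncomputable section

namespace Gocha

/-! ### Pro-`p` groups -/

section Groups

variable {G : Type*} [Group G] [TopologicalSpace G]
variable {F : Type*} [Group F] [TopologicalSpace F]

/-- A profinite group is a pro-`p` group when all its quotients by open normal subgroups are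
`p`-groups (profiniteness is expressed by the usual topological type classes). -/
def IsProP (p : ℕ) (G : Type*) [Group G] [TopologicalSpace G] : Prop :=
  ∀ U : OpenNormalSubgroup G, IsPGroup p (G ⧸ U.toSubgroup)

/-- The pro-`p` group `F` is free pro-`p` on the (finite) family `x`: every map from the index set
to a finite `p`-group `P` extends uniquely to a continuous homomorphism `F → P`
(`P` is discrete, so continuity means that the kernel is open). -/
def IsFreeProP (p : ℕ) {J : Type*} (x : J → F) : Prop :=
  ∀ (P : Type) [Group P] [Finite P], IsPGroup p P → ∀ f : J → P,
    ∃! φ : F →* P, IsOpen (φ.ker : Set F) ∧ ∀ j, φ (x j) = f j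

/-- `h = g ^ z` for a `p`-adic exponent `z`, i.e. `h` is the limit of the powers `g ^ z_k`, where
`z_k` is the natural number congruent to `z` modulo `p ^ k` in `[0, p ^ k)`. -/
def IsPadicPow {p : ℕ} [Fact p.Prime] (g : G) (z : ℤ_[p]) (h : G) : Prop :=
  Tendsto (fun k : ℕ => g ^ z.appr k) atTop (𝓝 h)

/-- Preimage of an open normal subgroup under a continuous homomorphism. -/
def comapOpen (f : F →* G) (hf : Continuous f) (U : OpenNormalSubgroup G) :
    OpenNormalSubgroup F where
  toOpenSubgroup := U.toOpenSubgroup.comap f hf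
  isNormal' := by
    have : U.toSubgroup.Normal := U.isNormal'
    exact Subgroup.Normal.comap this f

/-- The whole group, as an open normal subgroup. -/
def topOpen (G : Type*) [Group G] [TopologicalSpace G] : OpenNormalSubgroup G where
  toOpenSubgroup := ⊤
  isNormal' := by
    change (⊤ : Subgroup G).Normal
    infer_instance

/-- The homomorphism `F / f⁻¹ U → G / U` induced by `f`. -/
def quotMap (f : F →* G) (hf : Continuous f) (U : OpenNormalSubgroup G) :
    F ⧸ (comapOpen f hf U).toSubgroup →* G ⧸ U.toSubgroup :=
  QuotientGroup.map _ _ f (fun _ hx => hx)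

/-- The projection `G / U → G / V` for `U ≤ V`. -/
def quotProj {U V : OpenNormalSubgroup G} (h : U.toSubgroup ≤ V.toSubgroup) :
    G ⧸ U.toSubgroup →* G ⧸ V.toSubgroup :=
  QuotientGroup.map _ _ (MonoidHom.id G) h

end Groups

/-! ### The completed group algebra -/

section Algebra

variable (A : Type*) [CommRing A]
variable (G : Type*) [Group G] [TopologicalSpace G]
variable {F : Type*} [Group F] [TopologicalSpace F]

/-- The completed group algebra `Al(A, G) = lim A[G / U]`, where `U` runs over the open normal
subgroups of `G`: the compatible families in the product of the group algebras `A[G / U]`. -/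
def Al : Subalgebra A (∀ U : OpenNormalSubgroup G, MonoidAlgebra A (G ⧸ U.toSubgroup)) where
  carrier := {a | ∀ (U V : OpenNormalSubgroup G) (h : U.toSubgroup ≤ V.toSubgroup),
    MonoidAlgebra.mapDomainAlgHom A A (quotProj h) (a U) = a V}
  mul_mem' := by
    intro a b ha hb U V h
    rw [Pi.mul_apply, Pi.mul_apply, map_mul, ha U V h, hb U V h]
  add_mem' := by
    intro a b ha hb U V h
    rw [Pi.add_apply, Pi.add_apply, map_add, ha U V h, hb U V h]
  algebraMap_mem' := by
    intro r U V h
    rw [Pi.algebraMap_apply, Pi.algebraMap_apply, AlgHom.commutes]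

variable {G}

/-- The canonical map from `G` to its completed group algebra. -/
def Al.of : G →* Al A G where
  toFun g := ⟨fun U => MonoidAlgebra.of A (G ⧸ U.toSubgroup) (QuotientGroup.mk g), by
    intro U V h
    simp [quotProj]
    rfl⟩
  map_one' := by
    ext1
    funext U
    exact map_one (MonoidAlgebra.of A (G ⧸ U.toSubgroup))
  map_mul' g h := by
    ext1
    funext U
    exact map_mul (MonoidAlgebra.of A (G ⧸ U.toSubgroup)) (QuotientGroup.mk g) (QuotientGroup.mk h)

/-- Functoriality of the completed group algebra in continuous homomorphisms. -/
def Al.map (f : F →* G) (hf : Continuous f) : Al A F →ₐ[A] Al A G :=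
  AlgHom.codRestrict
    (AlgHom.pi fun U : OpenNormalSubgroup G =>
      ((MonoidAlgebra.mapDomainAlgHom A A (quotMap f hf U)).comp
        (Pi.evalAlgHom A _ (comapOpen f hf U))).comp (Al A F).val)
    (Al A G) (by
      intro a U V h
      have h' : (comapOpen f hf U).toSubgroup ≤ (comapOpen f hf V).toSubgroup :=
        fun x hx => h hx
      have key := a.2 (comapOpen f hf U) (comapOpen f hf V) h'
      have e : (quotProj h).comp (quotMap f hf U) = (quotMap f hf V).comp (quotProj h') := by
        ext x
        rfl
      change MonoidAlgebra.mapDomainAlgHom A A (quotProj h)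
          (MonoidAlgebra.mapDomainAlgHom A A (quotMap f hf U) (a.1 (comapOpen f hf U))) =
        MonoidAlgebra.mapDomainAlgHom A A (quotMap f hf V) (a.1 (comapOpen f hf V))
      rw [← key, ← AlgHom.comp_apply, ← AlgHom.comp_apply,
        ← MonoidAlgebra.mapDomainAlgHom_comp, ← MonoidAlgebra.mapDomainAlgHom_comp, e])

variable (G)

/-- The augmentation `Al(A, G) → A`, the sum of the coefficients in any of the `A[G / U]`. -/
def aug : Al A G →ₐ[A] A :=
  ((MonoidAlgebra.lift A A (G ⧸ (topOpen G).toSubgroup) 1).comp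
    (Pi.evalAlgHom A _ (topOpen G))).comp (Al A G).val

/-- `Al_n(A, G)`, the `n`-th power of the augmentation ideal. -/
def AlIdeal (n : ℕ) : Ideal (Al A G) := RingHom.ker (aug A G) ^ n

/-- `Al_n(A, G)` as an `A`-submodule. -/
def AlFil (n : ℕ) : Submodule A (Al A G) := (AlIdeal A G n).restrictScalars A

variable {A G}

theorem aug_map (f : F →* G) (hf : Continuous f) (a : Al A F) :
    aug A G (Al.map A f hf a) = aug A F a := by
  have h : (topOpen F).toSubgroup ≤ (comapOpen f hf (topOpen G)).toSubgroup :=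
    fun _ _ => Subgroup.mem_top _
  have key := a.2 _ _ h
  change MonoidAlgebra.lift A A (G ⧸ (topOpen G).toSubgroup) 1
      (MonoidAlgebra.mapDomainAlgHom A A (quotMap f hf (topOpen G))
        (a.1 (comapOpen f hf (topOpen G)))) =
    MonoidAlgebra.lift A A (F ⧸ (topOpen F).toSubgroup) 1 (a.1 (topOpen F))
  rw [← key, ← AlgHom.comp_apply, ← AlgHom.comp_apply]
  congr 1
  ext x
  simp

theorem AlIdeal_map (f : F →* G) (hf : Continuous f) (n : ℕ) :
    ∀ a ∈ AlIdeal A F n, Al.map A f hf a ∈ AlIdeal A G n := by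
  induction n with
  | zero => intro a _; simp [AlIdeal, Submodule.pow_zero, Ideal.one_eq_top]
  | succ n ih =>
    intro a ha
    rw [AlIdeal, Submodule.pow_succ] at ha ⊢
    refine Submodule.smul_induction_on ha ?_ ?_
    · intro r hr s hs
      rw [smul_eq_mul, map_mul]
      refine Ideal.mul_mem_mul (ih r hr) ?_
      rw [RingHom.mem_ker] at hs ⊢
      rw [aug_map, hs]
    · intro x y hx hy
      rw [map_add]
      exact add_mem hx hy

end Algebra

/-! ### Graded pieces of a filtered module -/

section Graded

variable {A : Type*} [CommRing A] {V : Type*} [AddCommGroup V] [Module A V]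

/-- The graded piece `Fil n / Fil (n + 1)` of a decreasing filtration, as a submodule of
`V / Fil (n + 1)`. -/
def gr (Fil : ℕ → Submodule A V) (n : ℕ) : Submodule A (V ⧸ Fil (n + 1)) :=
  (Fil n).map (Fil (n + 1)).mkQ

/-- The submodule of `gr Fil n` generated by the classes of the elements of `S`. -/
def grSpan (Fil : ℕ → Submodule A V) (n : ℕ) (S : Set V) : Submodule A (V ⧸ Fil (n + 1)) :=
  Submodule.span A ((Fil (n + 1)).mkQ '' S)

end Graded

/-! ### The invariants `c_n^χ` and `a_n^χ` -/

section Eigenspaces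

variable (A : Type*) [CommRing A]
variable {G : Type*} [Group G] [TopologicalSpace G]

/-- `G_n(A) = {g ∈ G ; g - 1 ∈ Al_n(A, G)}`. -/
def grp (n : ℕ) : Set G := {g | Al.of A g - 1 ∈ AlFil A G n}

/-- `𝓔_n(A, G) = Al_n(A, G) / Al_{n+1}(A, G)`. -/
def calE (G : Type*) [Group G] [TopologicalSpace G] (n : ℕ) :
    Submodule A (Al A G ⧸ AlFil A G (n + 1)) :=
  gr (AlFil A G) n

/-- `𝓛_n(A, G) = G_n(A) / G_{n+1}(A)` with its structure of `A`-module, seen in `𝓔_n(A, G)` through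
the injective homomorphism sending the class of `g` to the class of `g - 1`.
(For `A = 𝔽_p`, or `A = ℤ_p` and `G` a finitely generated pro-`p` group, the image of this
homomorphism is already an `A`-submodule: the multiplication by `z ∈ ℤ_p` corresponds to
`g ↦ g ^ z`.) -/
def calL (G : Type*) [Group G] [TopologicalSpace G] (n : ℕ) :
    Submodule A (Al A G ⧸ AlFil A G (n + 1)) :=
  grSpan (AlFil A G) n {v | ∃ g ∈ grp (G := G) A n, v = Al.of A g - 1}

/-- The action of a continuous endomorphism of `G` on `Al(A, G) / Al_n(A, G)`. -/
def AlQuotMap (f : G →* G) (hf : Continuous f) (n : ℕ) :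
    (Al A G ⧸ AlFil A G n) →ₗ[A] (Al A G ⧸ AlFil A G n) :=
  Submodule.mapQ _ _ (Al.map A f hf).toLinearMap (fun a ha => AlIdeal_map f hf n a ha)

variable {p : ℕ} [Fact p.Prime] [Algebra ℤ_[p] A]
variable (Δ : Subgroup (MulAut G)) (hΔ : ∀ δ ∈ Δ, Continuous δ)

/-- The `χ`-eigenspace of `Al(A, G) / Al_n(A, G)`, for a character `χ` of `Δ`. The characters of
`Δ` over `A` are the homomorphisms from `Δ` to `ℤ_pˣ`, acting on `A`-modules through `ℤ_p → A`. -/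
def eig (χ : Δ →* ℤ_[p]ˣ) (n : ℕ) : Submodule A (Al A G ⧸ AlFil A G n) :=
  ⨅ δ : Δ, Module.End.eigenspace
    (AlQuotMap A ((δ : MulAut G) : G →* G) (hΔ δ δ.2) n) (algebraMap ℤ_[p] A (χ δ : ℤ_[p]))

/-- `c_n^χ(A)`, the rank over `A` of `𝓔_n(A, G)[χ]`. -/
def cEig (χ : Δ →* ℤ_[p]ˣ) (n : ℕ) : ℕ :=
  Module.finrank A ↥(calE A G n ⊓ eig A Δ hΔ χ (n + 1))

/-- `a_n^χ(A)`, the rank over `A` of `𝓛_n(A, G)[χ]`. -/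
def aEig (χ : Δ →* ℤ_[p]ˣ) (n : ℕ) : ℕ :=
  Module.finrank A ↥(calL A G n ⊓ eig A Δ hΔ χ (n + 1))

/-- The elements `x j` of `G` lift, for every character `χ`, an `A`-basis of `𝓛_1(A, G)[χ]`, given
by the classes of the `x j` with `ch j = χ`. -/
def LiftsEigenbasis {J : Type*} (x : J → G) (ch : J → (Δ →* ℤ_[p]ˣ)) : Prop :=
  ∀ χ : Δ →* ℤ_[p]ˣ,
    LinearIndependent A (fun j : {j : J // ch j = χ} =>
      (AlFil A G 2).mkQ (Al.of A (x j) - 1)) ∧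
    Submodule.span A (Set.range (fun j : {j : J // ch j = χ} =>
      (AlFil A G 2).mkQ (Al.of A (x j) - 1))) = calL A G 1 ⊓ eig A Δ hΔ χ 2

end Eigenspaces

/-! ### The `χ₀`-filtration -/

section Psi

variable {D : Type*} [CommGroup D]

/-- `ψ_{χ₀}(χ)`: the integer `i ∈ [1, q]` such that `χ = χ₀ ^ i` (the least such positive
integer), when `χ₀` generates a group of prime order `q`. -/
def psi (χ₀ χ : D) : ℕ := sInf {i : ℕ | 1 ≤ i ∧ χ₀ ^ i = χ}

end Psi

section ChiFiltration

variable (p : ℕ) (A : Type*) [CommRing A]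
variable {F : Type*} [Group F] [TopologicalSpace F]
variable {J : Type*} (x : J → F) (wt : J → ℕ)

/-- The image in `Al(A, F)` of the noncommutative monomial `X_{j₁} ⋯ X_{jᵣ}` under the inverse of
the Magnus isomorphism `Al(A, F) ≃ A⟨⟨X⟩⟩`, `x_j ↦ 1 + X_j`: the product of the `x_j - 1`. -/
def monomial (w : List J) : Al A F := (w.map fun j => Al.of A (x j) - 1).prod

/-- The degree of a monomial when `X_j` has degree `wt j`. -/
def wordWeight (w : List J) : ℕ := (w.map wt).sum

/-- `a = ∑ s_w X_w` in `Al(A, F) ≃ A⟨⟨X⟩⟩`: the finite partial sums converge to `a`, for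
the topology of `Al(A, F)` given by the kernels of the maps to `(A / p ^ k)[F / U]`. -/
def IsSeriesSum (s : List J → A) (a : Al A F) : Prop :=
  ∀ (U : OpenNormalSubgroup F) (k : ℕ), ∃ S₀ : Finset (List J), ∀ S : Finset (List J), S₀ ⊆ S →
    ∃ b : MonoidAlgebra A (F ⧸ U.toSubgroup),
      (a - ∑ w ∈ S, s w • monomial A x w).1 U = (p : A) ^ k • b

/-- The filtration of `Al(A, F) ≃ A⟨⟨X⟩⟩` by the degree, where `X_j` has degree `wt j`: its `n`-th
step consists of the series all of whose monomials have degree at least `n`. -/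
def serFil (n : ℕ) : Submodule A (Al A F) where
  carrier := {a | ∃ s : List J → A, (∀ w, s w ≠ 0 → n ≤ wordWeight wt w) ∧ IsSeriesSum p A x s a}
  zero_mem' := ⟨0, fun w h => absurd rfl h, fun U k => ⟨∅, fun S _ => ⟨0, by simp⟩⟩⟩
  add_mem' := by
    classical
    rintro a b ⟨s, hs, hsa⟩ ⟨t, ht, htb⟩
    refine ⟨s + t, ?_, ?_⟩
    · intro w hw
      by_cases h : s w = 0
      · exact ht w (fun h' => hw (by simp [h, h']))
      · exact hs w h
    · intro U k
      obtain ⟨S₁, h₁⟩ := hsa U k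
      obtain ⟨S₂, h₂⟩ := htb U k
      refine ⟨S₁ ∪ S₂, fun S hS => ?_⟩
      obtain ⟨c, hc⟩ := h₁ S (Finset.union_subset_left hS)
      obtain ⟨d, hd⟩ := h₂ S (Finset.union_subset_right hS)
      refine ⟨c + d, ?_⟩
      rw [smul_add, ← hc, ← hd, ← Pi.add_apply, ← Subalgebra.coe_add]
      refine congrArg (fun z : Al A F => z.1 U) ?_
      simp only [Pi.add_apply, add_smul, Finset.sum_add_distrib]
      exact add_sub_add_comm _ _ _ _
  smul_mem' := by
    rintro r a ⟨s, hs, hsa⟩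
    refine ⟨r • s, ?_, ?_⟩
    · intro w hw
      exact hs w (fun h => hw (by simp [h]))
    · intro U k
      obtain ⟨S₁, h₁⟩ := hsa U k
      refine ⟨S₁, fun S hS => ?_⟩
      obtain ⟨c, hc⟩ := h₁ S hS
      refine ⟨r • c, ?_⟩
      rw [smul_comm, ← hc, ← Pi.smul_apply, ← Subalgebra.coe_smul]
      refine congrArg (fun z : Al A F => z.1 U) ?_
      simp only [Pi.smul_apply, smul_sub, Finset.smul_sum, smul_assoc]

variable {G : Type*} [Group G] (π : F →* G)

/-- The two-sided ideal `I(A, R)` of `Al(A, F)` generated by the `r - 1`, `r ∈ R = ker π`. -/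
def relIdeal : Ideal (Al A F) :=
  (TwoSidedIdeal.span {a : Al A F | ∃ r ∈ π.ker, a = Al.of A r - 1}).asIdeal

/-- The quotient `E(A, G) = Al(A, F) / I(A, R)`. -/
abbrev EQuot : Type _ := Al A F ⧸ relIdeal A π

/-- The projection `Al(A, F) → E(A, G)`. -/
def toEQuot : Al A F →ₗ[A] EQuot A π := (relIdeal A π).mkQ.restrictScalars A

/-- The quotient filtration `E_{χ₀, n}(A, G)` on `E(A, G)`; here `wt j` is the degree of `X_j`. -/
def chiFil (n : ℕ) : Submodule A (EQuot A π) :=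
  (serFil p A x wt n).map (toEQuot A π)

/-- `G_{χ₀, n}(A)`: the `g ∈ G` whose image in `E(A, G)` is congruent to `1` modulo
`E_{χ₀, n}(A, G)`. The image of `g` in `E(A, G)` is that of any `f ∈ F` above `g`. -/
def chiGrp (n : ℕ) : Set G :=
  {g | ∃ f : F, π f = g ∧ toEQuot A π (Al.of A f - 1) ∈ chiFil p A x wt π n}

/-- `𝓔_{χ₀, n}(A, G) = E_{χ₀, n}(A, G) / E_{χ₀, n + 1}(A, G)`. -/
def chiE (n : ℕ) : Submodule A (EQuot A π ⧸ chiFil p A x wt π (n + 1)) :=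
  gr (chiFil p A x wt π) n

/-- `𝓛_{χ₀, n}(A, G) = G_{χ₀, n}(A) / G_{χ₀, n + 1}(A)` with its structure of `A`-module, seen in
`𝓔_{χ₀, n}(A, G)` through the injective homomorphism sending the class of `g` to that of
`g - 1`. -/
def chiL (n : ℕ) : Submodule A (EQuot A π ⧸ chiFil p A x wt π (n + 1)) :=
  grSpan (chiFil p A x wt π) n
    {v | ∃ f : F, π f ∈ chiGrp p A x wt π n ∧ v = toEQuot A π (Al.of A f - 1)}

/-- `c_{χ₀, n}(A)`, the rank over `A` of `𝓔_{χ₀, n}(A, G)`. -/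
def cChi (n : ℕ) : ℕ := Module.finrank A ↥(chiE p A x wt π n)

/-- `a_{χ₀, n}(A)`, the rank over `A` of `𝓛_{χ₀, n}(A, G)`. -/
def aChi (n : ℕ) : ℕ := Module.finrank A ↥(chiL p A x wt π n)

end ChiFiltration

end Gocha

end

/-!
The inequalities compare two filtrations of the completed group algebra `Al(A, G)`: the powers
`P j` of the augmentation ideal, and the weight filtration `Q m`, in which `X_j = x_j - 1` has
degree `ψ(χ_j)`. As the weights lie between `1` and `q`, one has `P n ≤ Q n` and
`Q (q n + 1) ≤ P (n + 1)`.

Let `δ₀` generate `Δ` and put `ζ = χ₀(δ₀)`. Diagonality gives `δ₀(X_j) ≡ ζ ^ ψ(χ_j) X_j` modulo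
higher weight, by the binomial expansion of a `p`-adic power (`IsLimPow.of_sub_mem`); hence `δ₀`
acts as `ζ ^ m` on `Q m / Q (m + 1)` (`sub_smul_mem_wtFil`). The pieces of the filtration that `Q`
induces on `P j / P (j + 1)` can be computed in either order (`relRank_exchange`, a form of the
Zassenhaus lemma), and `δ₀` acts as `ζ ^ m` on the `m`-th of them. Since `q` is invertible in `A`,
eigenvectors lift (`exists_eigenvector_sub_mem`), and since the differences of distinct powers of
`ζ` are invertible, an eigenvector for `ζ ^ i` only meets the pieces with `m ≡ i` modulo `q`.
Telescoping over `j` for fixed `m` bounds the graded pieces of `Q` by eigenspaces, and over `m` for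
fixed `j` the eigenspaces by the graded pieces of `Q`. All this is done in `EigenBifiltration`, for
the submodules spanned by a subset `S` that is stable under `δ₀` and closed under addition and
scalars up to higher terms. The choice `S = Al(A, G)` gives the inequalities between the `c`'s, and
`S = {g - 1}` those between the `a`'s: products of group elements give sums and `p`-adic powers
give multiples (`exists_mem_grpSet`).

It remains to see that the filtration defined through the presentation, by images of power series
in `Al(A, F) / I`, has the same graded pieces as `Q`. Neither the set of series nor the ideal `I` is
treated as closed: everything is compared modulo a power of the augmentation ideal, which has a
quotient that is finitely generated over `A` (`finite_quotient_AlFil`), hence `p`-adically separated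
by Krull's theorem, and whose quotients modulo powers of `p` are finite and factor through some
`A[H / U]`, because finitely generated left ideals are closed (`IsCoeffRing.mem_of_forall_ev`,
`exists_open_le_AlFil`). With the nilpotency of the augmentation ideal of a finite `p`-group modulo
`p ^ k`, this yields `serFil_eq_wtFil` and `comap_wtFil`, from which `cChi_eq_relRank` and
`aChi_eq_relRank` follow.
-/

noncomputable section

namespace Gocha

/-! ### Ranks modulo a submodule, and lifting of eigenvectors -/

section Ranks

variable {A : Type*} [CommRing A] {M : Type*} [AddCommGroup M] [Module A M]

/-- The rank of the image of `W` in `M / P`. -/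
def relRank (W P : Submodule A M) : ℕ := Module.finrank A ↥(W.map P.mkQ)

theorem finrank_map_add_finrank_inf_ker [IsDomain A] [IsNoetherianRing A] {N : Type*}
    [AddCommGroup N] [Module A N] [Module.Finite A M] (f : M →ₗ[A] N) (X : Submodule A M) :
    Module.finrank A ↥(X.map f) + Module.finrank A ↥(X ⊓ LinearMap.ker f) =
      Module.finrank A X := by
  rw [← (LinearMap.ker (f.domRestrict X)).finrank_quotient_add_finrank,
    LinearEquiv.finrank_eq (f.domRestrict X).quotKerEquivRange, LinearMap.range_domRestrict,
    LinearMap.ker_domRestrict,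
    LinearEquiv.finrank_eq (X.equivSubtypeMap ((LinearMap.ker f).comap X.subtype)),
    Submodule.map_comap_subtype]

theorem finrank_sup_add_finrank_inf [IsDomain A] [IsNoetherianRing A] [Module.Finite A M]
    (s t : Submodule A M) :
    Module.finrank A ↥(s ⊔ t) + Module.finrank A ↥(s ⊓ t) =
      Module.finrank A s + Module.finrank A t := by
  have h := Submodule.rank_sup_add_rank_inf_eq s t
  rw [← Submodule.finrank_eq_rank, ← Submodule.finrank_eq_rank, ← Submodule.finrank_eq_rank,
    ← Submodule.finrank_eq_rank] at h
  exact_mod_cast h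

theorem map_mkQ_eq_of_sup_eq {W W' P : Submodule A M} (h : W ⊔ P = W' ⊔ P) :
    W.map P.mkQ = W'.map P.mkQ := by
  have h' := congrArg (Submodule.map P.mkQ) h
  rwa [Submodule.map_sup, Submodule.map_sup, Submodule.mkQ_map_self, sup_bot_eq, sup_bot_eq] at h'

theorem relRank_congr {W W' P : Submodule A M} (h : W ⊔ P = W' ⊔ P) :
    relRank W P = relRank W' P := by
  rw [relRank, relRank, map_mkQ_eq_of_sup_eq h]

theorem map_mkQ_eq_bot {W P : Submodule A M} (h : W ≤ P) : W.map P.mkQ = ⊥ :=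
  LinearMap.le_ker_iff_map.1 (h.trans P.ker_mkQ.ge)

theorem relRank_of_le [Nontrivial A] {W P : Submodule A M} (h : W ≤ P) : relRank W P = 0 := by
  rw [relRank, map_mkQ_eq_bot h]
  exact finrank_bot A _

theorem relRank_add [IsDomain A] [IsNoetherianRing A] (W : Submodule A M) {P P' : Submodule A M}
    (h : P' ≤ P) [Module.Finite A (M ⧸ P')] :
    relRank W P + relRank (W ⊓ P) P' = relRank W P' := by
  have key := finrank_map_add_finrank_inf_ker (Submodule.factor h) (W.map P'.mkQ)
  have e1 : (W.map P'.mkQ).map (Submodule.factor h) = W.map P.mkQ := by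
    rw [← Submodule.map_comp]
    congr 1
  have e2 : W.map P'.mkQ ⊓ LinearMap.ker (Submodule.factor h) = (W ⊓ P).map P'.mkQ := by
    apply le_antisymm
    · rintro _ ⟨⟨w, hw, rfl⟩, hk⟩
      rw [SetLike.mem_coe, LinearMap.mem_ker] at hk
      exact ⟨w, ⟨hw, (Submodule.Quotient.mk_eq_zero P).1 hk⟩, rfl⟩
    · rintro _ ⟨w, ⟨hw, hwP⟩, rfl⟩
      refine ⟨⟨w, hw, rfl⟩, ?_⟩
      exact (Submodule.Quotient.mk_eq_zero P).2 hwP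
  rw [e1, e2] at key
  exact key

/-- A linear map `f` through which `P = f⁻¹ P'` and under which `W` and `W'` agree modulo `P'`
preserves relative ranks. -/
theorem relRank_eq_of_map {N : Type*} [AddCommGroup N] [Module A N] (f : M →ₗ[A] N)
    {W P : Submodule A M} {W' P' : Submodule A N} (hP : P'.comap f = P)
    (hW : W.map f ⊔ P' = W' ⊔ P') : relRank W P = relRank W' P' := by
  have hle : P ≤ P'.comap f := hP.ge
  let g : (M ⧸ P) →ₗ[A] (N ⧸ P') := P.mapQ P' f hle
  have hg : Function.Injective g := by
    rw [← LinearMap.ker_eq_bot, Submodule.ker_mapQ, hP, Submodule.mkQ_map_self]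
  have e : (W.map P.mkQ).map g = W'.map P'.mkQ := by
    rw [← map_mkQ_eq_of_sup_eq hW, ← Submodule.map_comp, ← Submodule.map_comp,
      Submodule.mapQ_mkQ]
  rw [relRank, relRank, ← e]
  exact LinearEquiv.finrank_eq (Submodule.equivMapOfInjective g hg _)

/-- If `D ^ q = 1` with `q` invertible, eigenvectors modulo a stable submodule lift to
eigenvectors: the projector `q⁻¹ ∑ ζ ^ (- k) D ^ k` does it. -/
theorem exists_eigenvector_sub_mem {q : ℕ} (hq : IsUnit (q : A)) {ζ : A} (hζ : ζ ^ q = 1)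
    (D : M →ₗ[A] M) (hD : D ^ q = 1) {K K' : Submodule A M} (hK : ∀ v ∈ K, D v ∈ K)
    (hK' : ∀ v ∈ K', D v ∈ K') {v : M} (hv : v ∈ K) (hDv : D v - ζ • v ∈ K') :
    ∃ v' ∈ K, D v' = ζ • v' ∧ v - v' ∈ K' := by
  obtain ⟨u, hu⟩ := hq
  have hpow : ∀ i : ℕ, (D ^ i) v - ζ ^ i • v ∈ K' := by
    intro i
    induction i with
    | zero => simp
    | succ i ih =>
      have h1 := K'.add_mem (hK' _ ih) (K'.smul_mem (ζ ^ i) hDv)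
      have h2 : D ((D ^ i) v - ζ ^ i • v) + ζ ^ i • (D v - ζ • v) =
          (D ^ (i + 1)) v - ζ ^ (i + 1) • v := by
        rw [pow_succ' D, pow_succ ζ, Module.End.mul_apply, map_sub, map_smul, smul_sub, smul_smul]
        abel
      rwa [h2] at h1
  have hpowK : ∀ i : ℕ, (D ^ i) v ∈ K := by
    intro i
    induction i with
    | zero => simpa using hv
    | succ i ih =>
      rw [pow_succ', Module.End.mul_apply]
      exact hK _ ih
  -- `D ^ q - ζ ^ q = (D - ζ) T`, so that `T` takes values in the eigenspace
  let T : M →ₗ[A] M := ∑ i ∈ Finset.range q, D ^ i * (algebraMap A (Module.End A M) ζ) ^ (q - 1 - i)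
  have hT : D (T v) = ζ • T v := by
    have hc : Commute D (algebraMap A (Module.End A M) ζ) := (Algebra.commutes ζ D).symm
    have h := hc.mul_geom_sum₂ q
    rw [hD, ← map_pow, hζ, map_one, sub_self] at h
    have h' := LinearMap.congr_fun h v
    rw [Module.End.mul_apply, LinearMap.sub_apply, Module.algebraMap_end_apply,
      LinearMap.zero_apply, sub_eq_zero] at h'
    exact h'
  have hTv : T v = ∑ i ∈ Finset.range q, ζ ^ (q - 1 - i) • (D ^ i) v := by
    simp only [T, LinearMap.sum_apply, Module.End.mul_apply, ← map_pow,
      Module.algebraMap_end_apply, map_smul]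
  refine ⟨((↑u⁻¹ : A) * ζ) • T v, K.smul_mem _ ?_, ?_, ?_⟩
  · rw [hTv]
    exact K.sum_mem fun i _ => K.smul_mem _ (hpowK i)
  · rw [map_smul, hT, smul_comm]
  · have h1 : v = ((↑u⁻¹ : A) * ζ) • ∑ i ∈ Finset.range q, ζ ^ (q - 1 - i) • ζ ^ i • v := by
      have h2 : ∀ i ∈ Finset.range q, ζ ^ (q - 1 - i) • ζ ^ i • v = ζ ^ (q - 1) • v := by
        intro i hi
        rw [smul_smul, ← pow_add]
        congr 2
        have := Finset.mem_range.1 hi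
        omega
      rw [Finset.sum_congr rfl h2, Finset.sum_const, Finset.card_range, ← Nat.cast_smul_eq_nsmul A,
        smul_smul, smul_smul, ← hu]
      rcases Nat.eq_zero_or_pos q with h0 | h0
      · have : (u : A) = 0 := by rw [hu, h0, Nat.cast_zero]
        have hA : (1 : A) = 0 := by rw [← u.inv_mul, this, mul_zero]
        rw [← one_smul A v, hA, zero_smul, smul_zero]
      · have h3 : (↑u⁻¹ : A) * ζ * (↑u * ζ ^ (q - 1)) = 1 := by
          calc (↑u⁻¹ : A) * ζ * (↑u * ζ ^ (q - 1)) = (↑u⁻¹ * ↑u) * (ζ ^ (q - 1) * ζ) := by ring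
            _ = 1 := by rw [u.inv_mul, ← pow_succ, Nat.sub_add_cancel h0, hζ, one_mul]
        rw [← mul_assoc] at h3
        rw [h3, one_smul]
    have h4 : v - ((↑u⁻¹ : A) * ζ) • T v = ((↑u⁻¹ : A) * ζ) •
        ∑ i ∈ Finset.range q, ζ ^ (q - 1 - i) • -((D ^ i) v - ζ ^ i • v) := by
      conv_lhs => enter [1]; rw [h1]
      rw [hTv, ← smul_sub, ← Finset.sum_sub_distrib]
      simp only [neg_sub, smul_sub]
    rw [h4]
    exact K'.smul_mem _ (K'.sum_mem fun i _ => K'.smul_mem _ (K'.neg_mem (hpow i)))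

end Ranks

/-! ### Two filtrations and an operator of finite order -/

section Bifiltration

/-- Two decreasing filtrations `P`, `Q` of a module with an operator `D` of order dividing `q`,
acting as `ζ ^ m` on `Q m / Q (m + 1)`, together with a stable subset `S` whose traces on the
`P j ⊓ Q m` have submodules as images modulo `P (j + 1) ⊓ Q (m + 1)`. For `S` the whole module this
computes the ranks of the graded pieces; for `S = {g - 1}` it does so for the graded pieces of the
group. -/
structure EigenBifiltration (A : Type*) [CommRing A] (M : Type*) [AddCommGroup M] [Module A M]
    (q : ℕ) where
  P : ℕ → Submodule A M
  Q : ℕ → Submodule A M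
  D : M →ₗ[A] M
  ζ : A
  S : Set M
  P_anti : Antitone P
  Q_anti : Antitone Q
  P_zero : P 0 = ⊤
  P_le_Q : ∀ n, P n ≤ Q n
  Q_le_P : ∀ n, Q (q * n + 1) ≤ P (n + 1)
  map_P : ∀ n, P n ≤ (P n).comap D
  map_Q : ∀ n, Q n ≤ (Q n).comap D
  D_sub : ∀ m, ∀ v ∈ Q m, D v - ζ ^ m • v ∈ Q (m + 1)
  D_pow : D ^ q = 1
  ζ_pow : ζ ^ q = 1
  isUnit_q : IsUnit (q : A)
  ζ_sub : ∀ a b, a ≡ b [MOD q] ∨ IsUnit (ζ ^ a - ζ ^ b)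
  map_S : ∀ s ∈ S, D s ∈ S
  exists_mem : ∀ m j, ∀ v ∈ Submodule.span A (S ∩ (P j ∩ Q m)),
    ∃ s ∈ S, s ∈ P j ∧ s ∈ Q m ∧ v - s ∈ P (j + 1) ∧ v - s ∈ Q (m + 1)
  finite : ∀ n, Module.Finite A (M ⧸ P n)

namespace EigenBifiltration

variable {A : Type*} [CommRing A] {M : Type*} [AddCommGroup M] [Module A M] {q : ℕ}
  (B : EigenBifiltration A M q)

/-- The span of `S ∩ Q m ∩ P j`. -/
def sp (m j : ℕ) : Submodule A M := Submodule.span A (B.S ∩ (B.P j ∩ B.Q m))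

theorem sp_le_P (m j : ℕ) : B.sp m j ≤ B.P j :=
  Submodule.span_le.2 fun _ hx => hx.2.1

theorem sp_le_Q (m j : ℕ) : B.sp m j ≤ B.Q m :=
  Submodule.span_le.2 fun _ hx => hx.2.2

theorem sp_mono {m m' j j' : ℕ} (hm : m' ≤ m) (hj : j' ≤ j) : B.sp m j ≤ B.sp m' j' :=
  Submodule.span_mono fun _ hx => ⟨hx.1, B.P_anti hj hx.2.1, B.Q_anti hm hx.2.2⟩

theorem map_sp (m j : ℕ) : B.sp m j ≤ (B.sp m j).comap B.D := by
  refine Submodule.span_le.2 fun x hx => ?_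
  exact Submodule.subset_span ⟨B.map_S x hx.1, B.map_P j hx.2.1, B.map_Q m hx.2.2⟩

/-- The operator induced by `D` on `M / P j`. -/
def DP (j : ℕ) : (M ⧸ B.P j) →ₗ[A] (M ⧸ B.P j) := (B.P j).mapQ (B.P j) B.D (B.map_P j)

theorem DP_mk (j : ℕ) (v : M) : B.DP j ((B.P j).mkQ v) = (B.P j).mkQ (B.D v) := rfl

theorem DP_pow (j : ℕ) : B.DP j ^ q = 1 := by
  have h : ∀ i (v : M), (B.DP j ^ i) ((B.P j).mkQ v) = (B.P j).mkQ ((B.D ^ i) v) := by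
    intro i v
    induction i with
    | zero => rfl
    | succ i ih =>
      rw [pow_succ', pow_succ', Module.End.mul_apply, ih, Module.End.mul_apply, DP_mk]
  refine LinearMap.ext fun v => ?_
  obtain ⟨v, rfl⟩ := (B.P j).mkQ_surjective v
  rw [h, B.D_pow]
  rfl

/-- The image of `S ∩ Q m ∩ P j` in `M / P (j + 1)`. -/
def LP (m j : ℕ) : Submodule A (M ⧸ B.P (j + 1)) := (B.sp m j).map (B.P (j + 1)).mkQ

theorem LP_anti (j : ℕ) {m m' : ℕ} (h : m ≤ m') : B.LP m' j ≤ B.LP m j :=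
  Submodule.map_mono (B.sp_mono h le_rfl)

theorem map_LP (m j : ℕ) : ∀ v ∈ B.LP m j, B.DP (j + 1) v ∈ B.LP m j := by
  rintro _ ⟨v, hv, rfl⟩
  exact ⟨B.D v, B.map_sp m j hv, rfl⟩

/-- `D` acts as `ζ ^ m` on `LP m j / LP (m + 1) j`: the element of `S` that represents
`D v - ζ ^ m v` modulo `P (j + 1)` lies in `Q (m + 1)`. -/
theorem DP_sub_mem (m j : ℕ) :
    ∀ v ∈ B.LP m j, B.DP (j + 1) v - B.ζ ^ m • v ∈ B.LP (m + 1) j := by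
  rintro _ ⟨v, hv, rfl⟩
  have hw : B.D v - B.ζ ^ m • v ∈ B.sp m j :=
    sub_mem (B.map_sp m j hv) (Submodule.smul_mem _ _ hv)
  obtain ⟨s, hs, hsP, hsQ, h1, h2⟩ := B.exists_mem m j _ hw
  refine ⟨s, Submodule.subset_span ⟨hs, hsP, ?_⟩, ?_⟩
  · have h3 := sub_mem (B.D_sub m v (B.sp_le_Q m j hv)) h2
    rwa [sub_sub_cancel] at h3
  · rw [DP_mk, ← map_smul, ← map_sub, eq_comm, ← sub_eq_zero, ← map_sub]
    exact (Submodule.Quotient.mk_eq_zero _).2 h1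

theorem LP_eq_bot {m j : ℕ} (h : q * j + 1 ≤ m) : B.LP m j = ⊥ :=
  map_mkQ_eq_bot (((B.sp_le_Q m j).trans (B.Q_anti h)).trans (B.Q_le_P j))

theorem Q_le_P_add (hq : 1 ≤ q) (n i : ℕ) : B.Q (q * n + i) ≤ B.P n := by
  rcases n with _ | n
  · rw [B.P_zero]
    exact le_top
  · refine (B.Q_anti ?_).trans (B.Q_le_P n)
    rw [Nat.mul_succ]
    omega

theorem sp_zero_left_eq {m j : ℕ} (h : m ≤ j) : B.sp m j = B.sp 0 j := by
  refine le_antisymm (B.sp_mono (Nat.zero_le m) le_rfl) (Submodule.span_mono fun x hx => ?_)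
  exact ⟨hx.1, hx.2.1, B.P_le_Q m (B.P_anti h hx.2.1)⟩

theorem sp_zero_right_eq {m n : ℕ} (h : B.Q m ≤ B.P n) : B.sp m n = B.sp m 0 := by
  refine le_antisymm (B.sp_mono le_rfl (Nat.zero_le n)) (Submodule.span_mono fun x hx => ?_)
  exact ⟨hx.1, h hx.2.2, hx.2.2⟩

theorem finite_inf (m j : ℕ) : Module.Finite A (M ⧸ (B.P j ⊓ B.Q m)) := by
  have := B.finite (max j m)
  have h : B.P (max j m) ≤ B.P j ⊓ B.Q m :=
    le_inf (B.P_anti (le_max_left j m)) ((B.P_anti (le_max_right j m)).trans (B.P_le_Q m))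
  exact Module.Finite.of_surjective (Submodule.factor h) (Submodule.factor_surjective h)

variable [IsDomain A] [IsNoetherianRing A]

theorem relRank_sp_add_left (m j : ℕ) :
    relRank (B.sp m j) (B.P (j + 1)) + relRank (B.sp m (j + 1)) (B.Q (m + 1)) =
      relRank (B.sp m j) (B.P (j + 1) ⊓ B.Q (m + 1)) := by
  have := B.finite_inf (m + 1) (j + 1)
  rw [← relRank_add (B.sp m j) (inf_le_left : B.P (j + 1) ⊓ B.Q (m + 1) ≤ _)]
  congr 1
  have h1 : relRank (B.sp m j ⊓ B.P (j + 1)) (B.P (j + 1) ⊓ B.Q (m + 1)) =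
      relRank (B.sp m (j + 1)) (B.P (j + 1) ⊓ B.Q (m + 1)) := by
    refine relRank_congr (le_antisymm (sup_le ?_ le_sup_right) (sup_le_sup_right ?_ _))
    · rintro v ⟨hv, hvP⟩
      obtain ⟨s, hs, hsP, hsQ, h1, h2⟩ := B.exists_mem m j v hv
      have hs' : s ∈ B.P (j + 1) := by
        have := sub_mem hvP h1
        rwa [sub_sub_cancel] at this
      rw [← add_sub_cancel s v]
      exact Submodule.add_mem_sup (Submodule.subset_span ⟨hs, hs', hsQ⟩) ⟨h1, h2⟩
    · exact le_inf (B.sp_mono le_rfl (Nat.le_succ j)) (B.sp_le_P m (j + 1))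
  rw [h1, ← relRank_add (B.sp m (j + 1)) (inf_le_right : B.P (j + 1) ⊓ B.Q (m + 1) ≤ _),
    relRank_of_le (inf_le_inf_right _ (B.sp_le_P m (j + 1))), add_zero]

theorem relRank_sp_add_right (m j : ℕ) :
    relRank (B.sp m j) (B.Q (m + 1)) + relRank (B.sp (m + 1) j) (B.P (j + 1)) =
      relRank (B.sp m j) (B.P (j + 1) ⊓ B.Q (m + 1)) := by
  have := B.finite_inf (m + 1) (j + 1)
  rw [← relRank_add (B.sp m j) (inf_le_right : B.P (j + 1) ⊓ B.Q (m + 1) ≤ _)]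
  congr 1
  have h1 : relRank (B.sp m j ⊓ B.Q (m + 1)) (B.P (j + 1) ⊓ B.Q (m + 1)) =
      relRank (B.sp (m + 1) j) (B.P (j + 1) ⊓ B.Q (m + 1)) := by
    refine relRank_congr (le_antisymm (sup_le ?_ le_sup_right) (sup_le_sup_right ?_ _))
    · rintro v ⟨hv, hvQ⟩
      obtain ⟨s, hs, hsP, hsQ, h1, h2⟩ := B.exists_mem m j v hv
      have hs' : s ∈ B.Q (m + 1) := by
        have := sub_mem hvQ h2
        rwa [sub_sub_cancel] at this
      rw [← add_sub_cancel s v]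
      exact Submodule.add_mem_sup (Submodule.subset_span ⟨hs, hsP, hs'⟩) ⟨h1, h2⟩
    · exact le_inf (B.sp_mono (m.le_add_right 1) le_rfl) (B.sp_le_Q (m + 1) j)
  rw [h1, ← relRank_add (B.sp (m + 1) j) (inf_le_left : B.P (j + 1) ⊓ B.Q (m + 1) ≤ _),
    relRank_of_le (le_inf inf_le_right (inf_le_left.trans (B.sp_le_Q (m + 1) j))), add_zero]

/-- Both sides of the exchange compute the rank of the `(m, j)` bigraded piece: this is the
Zassenhaus lemma for the two filtrations. -/
theorem relRank_exchange (m j : ℕ) :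
    relRank (B.sp m j) (B.P (j + 1)) + relRank (B.sp m (j + 1)) (B.Q (m + 1)) =
      relRank (B.sp m j) (B.Q (m + 1)) + relRank (B.sp (m + 1) j) (B.P (j + 1)) := by
  rw [relRank_sp_add_left, relRank_sp_add_right]

/-- The rank of the part of `LP m j` on which `D` acts as `ζ ^ i`. -/
def eigRank (i m j : ℕ) : ℕ :=
  Module.finrank A ↥(B.LP m j ⊓ Module.End.eigenspace (B.DP (j + 1)) (B.ζ ^ i))

/-- By the exchange, the difference of the ranks modulo `Q (m + 1)` is that of `LP m j` and
`LP (m + 1) j`; the quotient of these is generated by eigenvectors for `ζ ^ m`. -/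
theorem relRank_le_eigRank_add (m j : ℕ) :
    relRank (B.sp m j) (B.Q (m + 1)) ≤
      relRank (B.sp m (j + 1)) (B.Q (m + 1)) + B.eigRank m 0 j := by
  have := B.finite (j + 1)
  have h1 : B.LP m j ≤
      B.LP (m + 1) j ⊔ (B.LP 0 j ⊓ Module.End.eigenspace (B.DP (j + 1)) (B.ζ ^ m)) := by
    intro v hv
    have hζ : (B.ζ ^ m) ^ q = 1 := by rw [pow_right_comm, B.ζ_pow, one_pow]
    obtain ⟨v', hv', he, hs⟩ := exists_eigenvector_sub_mem B.isUnit_q hζ (B.DP (j + 1))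
      (B.DP_pow (j + 1)) (B.map_LP m j) (B.map_LP (m + 1) j) hv (B.DP_sub_mem m j v hv)
    rw [← sub_add_cancel v v']
    exact Submodule.add_mem_sup hs
      ⟨B.LP_anti j (Nat.zero_le m) hv', Module.End.mem_eigenspace_iff.2 he⟩
  have h2 := Submodule.finrank_mono h1
  have h3 := finrank_sup_add_finrank_inf (B.LP (m + 1) j)
    (B.LP 0 j ⊓ Module.End.eigenspace (B.DP (j + 1)) (B.ζ ^ m))
  have h4 := B.relRank_exchange m j
  have e (m' : ℕ) : Module.finrank A (B.LP m' j) = relRank (B.sp m' j) (B.P (j + 1)) := rfl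
  rw [e] at h2 h3
  change _ ≤ _ + Module.finrank A ↥(B.LP 0 j ⊓ Module.End.eigenspace (B.DP (j + 1)) (B.ζ ^ m))
  omega

theorem relRank_le_sum_eigRank (m a b : ℕ) (h : a ≤ b) :
    relRank (B.sp m a) (B.Q (m + 1)) ≤
      relRank (B.sp m b) (B.Q (m + 1)) + ∑ j ∈ Finset.Ico a b, B.eigRank m 0 j := by
  induction b, h using Nat.le_induction with
  | base => simp
  | succ b hb ih =>
    rw [Finset.sum_Ico_succ_top hb]
    have := B.relRank_le_eigRank_add m b
    omega

theorem relRank_Q_le_sum (n i : ℕ) (h : B.Q (q * n + i) ≤ B.P n) :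
    relRank (B.sp (q * n + i) 0) (B.Q (q * n + i + 1)) ≤
      ∑ j ∈ Finset.Icc n (q * n + i), B.eigRank (q * n + i) 0 j := by
  rcases le_or_gt n (q * n + i + 1) with h1 | h1
  · have h2 := B.relRank_le_sum_eigRank (q * n + i) n (q * n + i + 1) h1
    rw [relRank_of_le ((B.sp_le_P _ _).trans (B.P_le_Q _)), zero_add, B.sp_zero_right_eq h] at h2
    exact h2
  · rw [relRank_of_le]
    · exact Nat.zero_le _
    · exact (B.sp_le_Q _ _).trans (h.trans ((B.P_anti h1.le).trans (B.P_le_Q _)))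

/-- The eigenspace loses at most the rank of `LP m j / LP (m + 1) j`, which by the exchange is at
most that of the `m`-th graded piece of `Q`. -/
theorem eigRank_le_eigRank_succ_add (i m j : ℕ) :
    B.eigRank i m j ≤ B.eigRank i (m + 1) j + relRank (B.sp m 0) (B.Q (m + 1)) := by
  have := B.finite (j + 1)
  have h1 := finrank_sup_add_finrank_inf (B.LP (m + 1) j)
    (B.LP m j ⊓ Module.End.eigenspace (B.DP (j + 1)) (B.ζ ^ i))
  have h2 : Module.finrank A ↥(B.LP (m + 1) j ⊔
      (B.LP m j ⊓ Module.End.eigenspace (B.DP (j + 1)) (B.ζ ^ i))) ≤ Module.finrank A (B.LP m j) :=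
    Submodule.finrank_mono (sup_le (B.LP_anti j (m.le_add_right 1)) inf_le_left)
  rw [← inf_assoc, inf_eq_left.2 (B.LP_anti j (m.le_add_right 1))] at h1
  have h3 := B.relRank_exchange m j
  have := B.finite (m + 1)
  have h5 : Module.Finite A (M ⧸ B.Q (m + 1)) :=
    Module.Finite.of_surjective (Submodule.factor (B.P_le_Q (m + 1)))
      (Submodule.factor_surjective _)
  have h4 : relRank (B.sp m j) (B.Q (m + 1)) ≤ relRank (B.sp m 0) (B.Q (m + 1)) :=
    Submodule.finrank_mono (Submodule.map_mono (B.sp_mono le_rfl (Nat.zero_le j)))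
  have e (m' : ℕ) : Module.finrank A (B.LP m' j) = relRank (B.sp m' j) (B.P (j + 1)) := rfl
  rw [e] at h1 h2
  rw [eigRank, eigRank]
  omega

/-- `D` acts as `ζ ^ m` on `LP m j / LP (m + 1) j`, so that eigenvectors in `LP m j` for another
power of `ζ` lie in `LP (m + 1) j`. -/
theorem eigRank_le_of_not_modEq {i m : ℕ} (j : ℕ) (h : ¬ i ≡ m [MOD q]) :
    B.eigRank i m j ≤ B.eigRank i (m + 1) j := by
  have := B.finite (j + 1)
  refine Submodule.finrank_mono (le_inf ?_ inf_le_right)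
  rintro v ⟨hv, he⟩
  obtain ⟨u, hu⟩ := (B.ζ_sub i m).resolve_left h
  have h1 := B.DP_sub_mem m j v hv
  rw [Module.End.mem_eigenspace_iff.1 he, ← sub_smul, ← hu] at h1
  have h2 := (B.LP (m + 1) j).smul_mem (↑u⁻¹ : A) h1
  rwa [smul_smul, u.inv_mul, one_smul] at h2

theorem eigRank_le_eigRank_add_sum (i j a b : ℕ) (h : a ≤ b) :
    B.eigRank i a j ≤ B.eigRank i b j +
      ∑ m ∈ (Finset.Ico a b).filter (fun m => i ≡ m [MOD q]),
        relRank (B.sp m 0) (B.Q (m + 1)) := by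
  induction b, h using Nat.le_induction with
  | base => simp
  | succ b hb ih =>
    rw [Finset.sum_filter, Finset.sum_Ico_succ_top hb, ← Finset.sum_filter]
    by_cases hib : i ≡ b [MOD q]
    · have := B.eigRank_le_eigRank_succ_add i b j
      rw [if_pos hib]
      omega
    · have := B.eigRank_le_of_not_modEq j hib
      rw [if_neg hib]
      omega

theorem eigRank_le_sum_relRank (i j : ℕ) :
    B.eigRank i 0 j ≤
      ∑ m ∈ (Finset.Icc j (q * j)).filter (fun m => i ≡ m [MOD q]),
        relRank (B.sp m 0) (B.Q (m + 1)) := by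
  have e : B.eigRank i j j = B.eigRank i 0 j := by
    rw [eigRank, eigRank, LP, LP, B.sp_zero_left_eq le_rfl]
  have hb : ∀ m, q * j + 1 ≤ m → B.eigRank i m j = 0 := by
    intro m hm
    rw [eigRank, B.LP_eq_bot hm, bot_inf_eq, finrank_bot]
  rcases le_or_gt j (q * j + 1) with h | h
  · have h1 := B.eigRank_le_eigRank_add_sum i j j (q * j + 1) h
    rw [e, hb _ le_rfl, zero_add] at h1
    exact h1
  · rw [← e, hb _ h.le]
    exact Nat.zero_le _

end EigenBifiltration

end Bifiltration

/-! ### The coefficient rings -/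

section Coefficients

/-- The properties of `𝔽_p` and `ℤ_p` used below, uniformly in the two cases. -/
structure IsCoeffRing (p : ℕ) (A : Type*) [CommRing A] : Prop where
  isDomain : IsDomain A
  isNoetherianRing : IsNoetherianRing A
  isLocalRing : IsLocalRing A
  not_isUnit : ¬ IsUnit (p : A)
  exists_nat : ∀ (a : A) (k : ℕ), ∃ (n : ℕ) (b : A), a = n + (p : A) ^ k * b
  exists_topology : ∃ τ : TopologicalSpace A,
    @IsTopologicalRing A τ _ ∧ @CompactSpace A τ ∧ @T2Space A τ

theorem IsCoeffRing.of_ringEquiv {p : ℕ} {A B : Type*} [CommRing A] [CommRing B] (e : A ≃+* B)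
    (h : IsCoeffRing p B) : IsCoeffRing p A where
  isDomain := by
    have := h.isDomain
    exact e.toMulEquiv.isDomain B
  isNoetherianRing := by
    have := h.isNoetherianRing
    exact isNoetherianRing_of_ringEquiv B e.symm
  isLocalRing := by
    have := h.isLocalRing
    exact e.symm.isLocalRing
  not_isUnit hu := h.not_isUnit (by simpa using hu.map e)
  exists_nat a k := by
    obtain ⟨n, b, hb⟩ := h.exists_nat (e a) k
    refine ⟨n, e.symm b, e.injective ?_⟩
    simp [hb]
  exists_topology := by
    obtain ⟨τ, h1, h2, h3⟩ := h.exists_topology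
    let τ' : TopologicalSpace A := TopologicalSpace.induced e τ
    have hi : IsInducing e := ⟨rfl⟩
    refine ⟨τ', ?_, ?_, ?_⟩
    · have hm : ContinuousMul A := hi.continuousMul e
      have ha : ContinuousAdd A := hi.continuousAdd e
      have hn : ContinuousNeg A := hi.continuousNeg (map_neg e)
      exact { }
    · exact (e.toEquiv.toHomeomorphOfIsInducing hi).symm.compactSpace
    · exact (e.toEquiv.toHomeomorphOfIsInducing hi).symm.t2Space

variable {p : ℕ}

theorem isCoeffRing_zmod [Fact p.Prime] : IsCoeffRing p (ZMod p) where
  isDomain := inferInstance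
  isNoetherianRing := inferInstance
  isLocalRing := inferInstance
  not_isUnit := by simp
  exists_nat a k := ⟨a.val, 0, by simp⟩
  exists_topology := ⟨⊥, by
    let _ : TopologicalSpace (ZMod p) := ⊥
    have : DiscreteTopology (ZMod p) := ⟨rfl⟩
    exact ⟨inferInstance, inferInstance, inferInstance⟩⟩

theorem isCoeffRing_padicInt [Fact p.Prime] : IsCoeffRing p ℤ_[p] where
  isDomain := inferInstance
  isNoetherianRing := inferInstance
  isLocalRing := inferInstance
  not_isUnit := PadicInt.prime_p.not_isUnit
  exists_nat a k := by
    obtain ⟨b, hb⟩ := Ideal.mem_span_singleton.1 (PadicInt.appr_spec k a)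
    exact ⟨a.appr k, b, by rw [← hb]; ring⟩
  exists_topology := ⟨inferInstance, inferInstance, inferInstance, inferInstance⟩

namespace IsCoeffRing

variable {A : Type*} [CommRing A] {M : Type*} [AddCommGroup M] [Module A M]

/-- A finitely generated module is separated for the `p`-adic topology (Krull). -/
theorem mem_of_forall_pow (hA : IsCoeffRing p A) (N : Submodule A M) [Module.Finite A (M ⧸ N)]
    {v : M} (h : ∀ k : ℕ, ∃ b : M, v - (p : A) ^ k • b ∈ N) : v ∈ N := by
  have := hA.isNoetherianRing
  have := hA.isLocalRing
  have hI : Ideal.span {(p : A)} ≠ ⊤ := by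
    rw [Ne, Ideal.span_singleton_eq_top]
    exact hA.not_isUnit
  have key := Ideal.iInf_pow_smul_eq_bot_of_isLocalRing (M := M ⧸ N) _ hI
  rw [← Submodule.Quotient.mk_eq_zero, ← Submodule.mem_bot A, ← key, Submodule.mem_iInf]
  intro k
  obtain ⟨b, hb⟩ := h k
  have e : (Submodule.Quotient.mk v : M ⧸ N) = (p : A) ^ k • Submodule.Quotient.mk b := by
    rw [← Submodule.Quotient.mk_smul]
    exact (Submodule.Quotient.eq N).2 hb
  rw [e, Ideal.span_singleton_pow]
  exact Submodule.smul_mem_smul (Ideal.mem_span_singleton_self _) Submodule.mem_top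

theorem finite_of_pow_smul [Fact p.Prime] (hA : IsCoeffRing p A) [Module.Finite A M] {k : ℕ}
    (h : ∀ v : M, (p : A) ^ k • v = 0) : Finite M := by
  obtain ⟨s, hs⟩ := (Module.finite_def.1 ‹Module.Finite A M›)
  -- modulo `p ^ k` scalars are integers, so that generators of the module generate the group
  let N : Submodule A M :=
    { AddSubgroup.closure (s : Set M) with
      smul_mem' := by
        intro a v hv
        obtain ⟨n, b, hb⟩ := hA.exists_nat a k
        change a • v ∈ AddSubgroup.closure (s : Set M)
        rw [hb, add_smul, mul_comm, mul_smul, h, smul_zero, add_zero, Nat.cast_smul_eq_nsmul]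
        exact AddSubgroup.nsmul_mem _ hv n }
  have hN : N = ⊤ := by
    rw [← top_le_iff, ← hs]
    exact Submodule.span_le.2 (AddSubgroup.subset_closure)
  have hfg : AddGroup.FG M := by
    refine ⟨⟨s, ?_⟩⟩
    rw [← top_le_iff]
    intro v _
    have : v ∈ N := hN ▸ Submodule.mem_top
    exact this
  have htor : IsAddTorsion M := by
    intro v
    rw [isOfFinAddOrder_iff_nsmul_eq_zero]
    refine ⟨p ^ k, pow_pos (Fact.out : p.Prime).pos k, ?_⟩
    rw [← Nat.cast_smul_eq_nsmul A, Nat.cast_pow, h]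
  exact AddCommGroup.finite_of_fg_isAddTorsion M htor

end IsCoeffRing

theorem prime_dvd_card_of_pow_smul [Fact p.Prime] {V : Type*} [AddCommGroup V] [Finite V]
    [Nontrivial V] {k : ℕ}
    (h : ∀ v : V, p ^ k • v = 0) : p ∣ Nat.card V := by
  obtain ⟨l, hl, hd⟩ := Nat.exists_prime_and_dvd (Finite.one_lt_card (α := V)).ne'
  have := Fact.mk hl
  obtain ⟨v, hv⟩ := exists_prime_addOrderOf_dvd_card' l hd
  have h1 : l ∣ p ^ k := hv ▸ addOrderOf_dvd_of_nsmul_eq_zero (h v)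
  rwa [← (Nat.prime_dvd_prime_iff_eq hl Fact.out).1 (hl.dvd_of_dvd_pow h1)]

end Coefficients

/-! ### Powers of the augmentation ideal of a finite `p`-group -/

section Nilpotency

variable (A : Type*) [CommRing A] (P : Type*) [Group P]

/-- The augmentation `A[P] → A`. -/
def augP : MonoidAlgebra A P →ₐ[A] A := MonoidAlgebra.lift A A P 1

theorem augP_of (g : P) : augP A P (MonoidAlgebra.of A P g) = 1 := by
  simp [augP]

variable {A P}

theorem mem_of_augP_eq_zero (N : Submodule A (MonoidAlgebra A P))
    (h : ∀ g, MonoidAlgebra.of A P g - 1 ∈ N) {a : MonoidAlgebra A P} (ha : augP A P a = 0) :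
    a ∈ N := by
  have key : ∀ a : MonoidAlgebra A P, a - algebraMap A _ (augP A P a) ∈ N := by
    intro a
    induction a using MonoidAlgebra.induction_on with
    | of g =>
      rw [augP_of, map_one]
      exact h g
    | add a b ha hb =>
      rw [map_add, map_add, add_sub_add_comm]
      exact N.add_mem ha hb
    | smul r a ha =>
      rw [map_smul, smul_eq_mul, map_mul, Algebra.algebraMap_eq_smul_one, smul_mul_assoc, one_mul,
        ← smul_sub]
      exact N.smul_mem r ha
  have := key a
  rwa [ha, map_zero, sub_zero] at this

variable {p : ℕ} [Fact p.Prime]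

/-- A power of the augmentation ideal of a `p`-group kills a finite module of `p`-power exponent:
the fixed points of a non-zero such module are non-zero. -/
theorem exists_pow_ker_augP_smul_eq_zero (hP : IsPGroup p P) (k : ℕ) (n : ℕ) :
    ∀ (V : Type*) [AddCommGroup V] [Module (MonoidAlgebra A P) V] [Finite V],
      Nat.card V ≤ n → (∀ v : V, p ^ k • v = 0) →
      ∃ N : ℕ, ∀ a ∈ RingHom.ker (augP A P) ^ N, ∀ v : V, a • v = 0 := by
  induction n with
  | zero =>
    intro V _ _ _ hV _
    exact absurd hV (Nat.not_le.2 Nat.card_pos)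
  | succ n ih =>
    intro V _ _ _ hV hk
    rcases subsingleton_or_nontrivial V with hs | hn
    · exact ⟨0, fun _ _ _ => Subsingleton.elim _ _⟩
    -- the fixed points of `P`
    let W : Submodule (MonoidAlgebra A P) V :=
      { carrier := {v | ∀ a ∈ RingHom.ker (augP A P), a • v = 0}
        zero_mem' := fun a _ => smul_zero a
        add_mem' := fun {v w} hv hw a ha => by rw [smul_add, hv a ha, hw a ha, add_zero]
        smul_mem' := fun c v hv a ha => by
          rw [smul_smul]
          exact hv _ (by rw [RingHom.mem_ker] at ha ⊢; rw [map_mul, ha, zero_mul]) }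
    let _ : MulAction P V := MulAction.compHom V (MonoidAlgebra.of A P)
    have hsmul : ∀ (g : P) (v : V), g • v = MonoidAlgebra.of A P g • v := fun _ _ => rfl
    have hW : W ≠ ⊥ := by
      obtain ⟨v, hv, hv0⟩ := hP.exists_fixed_point_of_prime_dvd_card_of_fixed_point V
        (prime_dvd_card_of_pow_smul hk) (a := 0) (fun g => by rw [hsmul, smul_zero])
      refine fun hb => hv0 ?_
      have : v ∈ W := by
        intro a ha
        let N : Submodule A (MonoidAlgebra A P) :=
          (LinearMap.ker (LinearMap.toSpanSingleton (MonoidAlgebra A P) V v)).restrictScalars A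
        refine mem_of_augP_eq_zero N (fun g => ?_) ha
        change (MonoidAlgebra.of A P g - 1) • v = 0
        rw [sub_smul, one_smul, ← hsmul, hv g, sub_self]
      rw [hb, Submodule.mem_bot] at this
      exact this.symm
    have : Finite (V ⧸ W) := Finite.of_surjective _ W.mkQ_surjective
    have hcard : Nat.card (V ⧸ W) ≤ n := by
      have h1 := W.card_eq_card_quotient_mul_card
      have h2 : 1 < Nat.card W := by
        have := (Submodule.nontrivial_iff_ne_bot).2 hW
        exact Finite.one_lt_card
      have h3 : 0 < Nat.card (V ⧸ W) := Nat.card_pos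
      nlinarith
    obtain ⟨N, hN⟩ := ih (V ⧸ W) hcard (fun v => by
      obtain ⟨v, rfl⟩ := W.mkQ_surjective v
      rw [← map_nsmul, hk, map_zero])
    have hN' : ∀ z ∈ RingHom.ker (augP A P) ^ (N + 1), ∀ v : V ⧸ W, z • v = 0 := by
      intro z hz v
      rw [Submodule.pow_succ] at hz
      refine Submodule.smul_induction_on hz (fun y hy z _ => ?_) (fun x y hx hy => ?_)
      · rw [smul_eq_mul, mul_smul, hN y hy]
      · rw [add_smul, hx, hy, add_zero]
    refine ⟨N + 2, fun a ha v => ?_⟩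
    rw [Submodule.pow_succ' _ N.succ_ne_zero] at ha
    refine Submodule.smul_induction_on ha ?_ ?_
    · intro y hy z hz
      rw [smul_eq_mul, mul_smul]
      have h1 : z • v ∈ W := by
        rw [← Submodule.Quotient.mk_eq_zero, Submodule.Quotient.mk_smul]
        exact hN' z hz _
      exact h1 y hy
    · intro x y hx hy
      rw [add_smul, hx, hy, add_zero]

theorem exists_pow_ker_augP_le (hA : IsCoeffRing p A) [Finite P] (hP : IsPGroup p P) (k : ℕ) :
    ∃ N : ℕ, ∀ a ∈ RingHom.ker (augP A P) ^ N, ∃ b, a = (p : A) ^ k • b := by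
  let I : Ideal (MonoidAlgebra A P) := Ideal.span {(p : MonoidAlgebra A P) ^ k}
  have hk : ∀ v : MonoidAlgebra A P ⧸ I, (p : A) ^ k • v = 0 := by
    intro v
    obtain ⟨v, rfl⟩ := I.mkQ_surjective v
    change Submodule.Quotient.mk ((p : A) ^ k • v) = (0 : MonoidAlgebra A P ⧸ I)
    rw [Submodule.Quotient.mk_eq_zero, ← Nat.cast_pow, Nat.cast_smul_eq_nsmul, nsmul_eq_mul,
      Nat.cast_comm, Nat.cast_pow]
    exact I.mul_mem_left v (Ideal.subset_span rfl)
  have : Module.Finite A (MonoidAlgebra A P) := inferInstance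
  have : Module.Finite A (MonoidAlgebra A P ⧸ I) := Module.Finite.of_surjective
    (I.mkQ.restrictScalars A) I.mkQ_surjective
  have : Finite (MonoidAlgebra A P ⧸ I) := hA.finite_of_pow_smul hk
  obtain ⟨N, hN⟩ := exists_pow_ker_augP_smul_eq_zero (A := A) hP k _ (MonoidAlgebra A P ⧸ I) le_rfl
    (fun v => by
      have := hk v
      rwa [← Nat.cast_pow, Nat.cast_smul_eq_nsmul] at this)
  refine ⟨N, fun a ha => ?_⟩
  have h1 := hN a ha (Submodule.Quotient.mk 1)
  rw [← Submodule.Quotient.mk_smul, smul_eq_mul, mul_one, Submodule.Quotient.mk_eq_zero] at h1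
  obtain ⟨b, hb⟩ := Ideal.mem_span_singleton'.1 h1
  refine ⟨b, ?_⟩
  rw [← hb, ← Nat.cast_pow, ← Nat.cast_pow, Nat.cast_smul_eq_nsmul, nsmul_eq_mul, Nat.cast_comm]

end Nilpotency

/-! ### Closed left ideals of the completed group algebra -/

section Closedness

variable (A : Type*) [CommRing A] {H : Type*} [Group H] [TopologicalSpace H]

/-- The projection `Al(A, H) → A[H / U]`. -/
def Al.ev (U : OpenNormalSubgroup H) : Al A H →ₐ[A] MonoidAlgebra A (H ⧸ U.toSubgroup) :=
  (Pi.evalAlgHom A _ U).comp (Al A H).val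

variable {A}

theorem Al.ext_ev {a b : Al A H} (h : ∀ U, Al.ev A U a = Al.ev A U b) : a = b :=
  Subtype.ext (funext h)

theorem Al.ev_of (U : OpenNormalSubgroup H) (g : H) :
    Al.ev A U (Al.of A g) = MonoidAlgebra.of A _ (QuotientGroup.mk g : H ⧸ U.toSubgroup) := rfl

theorem Al.map_ev {U V : OpenNormalSubgroup H} (h : U.toSubgroup ≤ V.toSubgroup) (a : Al A H) :
    MonoidAlgebra.mapDomainAlgHom A A (quotProj h) (Al.ev A U a) = Al.ev A V a := a.2 U V h

theorem augP_mapDomain {P P' : Type*} [Group P] [Group P'] (f : P →* P') (b : MonoidAlgebra A P) :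
    augP A P' (MonoidAlgebra.mapDomainAlgHom A A f b) = augP A P b := by
  rw [augP, augP, ← AlgHom.comp_apply]
  congr 1
  ext x
  simp

theorem Al.augP_ev (U : OpenNormalSubgroup H) (a : Al A H) :
    augP A _ (Al.ev A U a) = aug A H a := by
  have h : U.toSubgroup ≤ (topOpen H).toSubgroup := fun _ _ => Subgroup.mem_top _
  rw [← augP_mapDomain (quotProj h), Al.map_ev]
  rfl

theorem aug_of (g : H) : aug A H (Al.of A g) = 1 := by
  rw [← Al.augP_ev (topOpen H), Al.ev_of, augP_of]

variable (A) in
/-- The coefficients of an element of `A[P]`, for a finite group `P`. -/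
def coeffEquivFun (P : Type*) [Finite P] : MonoidAlgebra A P ≃ₗ[A] (P → A) :=
  (MonoidAlgebra.coeffLinearEquiv A).trans (Finsupp.linearEquivFunOnFinite A A P)

/-- Finitely generated left ideals of the completed group algebra are closed, by compactness of
the coefficient ring. -/
theorem IsCoeffRing.mem_of_forall_ev {p : ℕ} (hA : IsCoeffRing p A) [IsTopologicalGroup H]
    [CompactSpace H] {I : Ideal (Al A H)} (hI : I.FG) {a : Al A H}
    (h : ∀ U, ∃ b ∈ I, Al.ev A U b = Al.ev A U a) : a ∈ I := by
  obtain ⟨τ, h1, h2, h3⟩ := hA.exists_topology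
  obtain ⟨s, rfl⟩ := hI
  let E (U : OpenNormalSubgroup H) := coeffEquivFun A (H ⧸ U.toSubgroup)
  let Ω := s → ∀ U : OpenNormalSubgroup H, (H ⧸ U.toSubgroup → A)
  -- `K` is the set of families of compatible coefficients, `C U` that of the families solving the
  -- linear equation for `a` in `A[H / U]`
  let K : Set Ω := ⋂ (i : s) (U : OpenNormalSubgroup H) (V : OpenNormalSubgroup H)
    (h : U.toSubgroup ≤ V.toSubgroup), {f : Ω |
      E V (MonoidAlgebra.mapDomainAlgHom A A (quotProj h) ((E U).symm (f i U))) = f i V}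
  let C (U : OpenNormalSubgroup H) : Set Ω := {f : Ω |
      ∑ i : s, E U ((E U).symm (f i U) * Al.ev A U i) = E U (Al.ev A U a)}
  have hcoord (i : s) (U : OpenNormalSubgroup H) : Continuous (fun f : Ω => f i U) :=
    (continuous_apply U).comp (continuous_apply i)
  have hK : IsClosed K := by
    refine isClosed_iInter fun i => isClosed_iInter fun U => isClosed_iInter fun V =>
      isClosed_iInter fun h => isClosed_eq ?_ (hcoord i V)
    have := LinearMap.continuous_on_pi ((E V).toLinearMap ∘ₗ
      (MonoidAlgebra.mapDomainAlgHom A A (quotProj h)).toLinearMap ∘ₗ (E U).symm.toLinearMap)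
    exact this.comp (hcoord i U)
  have hC (U) : IsClosed (C U) := by
    refine isClosed_eq (continuous_finsetSum _ fun i _ => ?_) continuous_const
    have := LinearMap.continuous_on_pi ((E U).toLinearMap ∘ₗ
      (LinearMap.mulRight A (Al.ev A U i)) ∘ₗ (E U).symm.toLinearMap)
    exact this.comp (hcoord i U)
  have hmono {U V : OpenNormalSubgroup H} (h : U.toSubgroup ≤ V.toSubgroup) :
      K ∩ C U ⊆ K ∩ C V := by
    rintro f ⟨hf, hfU⟩
    refine ⟨hf, ?_⟩
    have h4 : ∑ i : s, (E U).symm (f i U) * Al.ev A U i = Al.ev A U a := by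
      apply (E U).injective
      rw [map_sum]
      exact hfU
    change ∑ i : s, E V ((E V).symm (f i V) * Al.ev A V i) = E V (Al.ev A V a)
    rw [← map_sum (E V), ← Al.map_ev h a, ← h4,
      map_sum (MonoidAlgebra.mapDomainAlgHom A A (quotProj h))]
    refine congrArg (E V) ?_
    refine Finset.sum_congr rfl fun i _ => ?_
    rw [map_mul, Al.map_ev]
    congr 1
    have h5 := Set.mem_iInter.1 (Set.mem_iInter.1 (Set.mem_iInter.1 (Set.mem_iInter.1 hf i) U) V) h
    rw [← (show _ = f i V from h5), LinearEquiv.symm_apply_apply]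
  have hne (U) : (K ∩ C U).Nonempty := by
    obtain ⟨b, hb, hba⟩ := h U
    obtain ⟨f, rfl⟩ := Submodule.mem_span_finset'.1 hb
    refine ⟨fun i V => E V (Al.ev A V (f i)), ?_, ?_⟩
    · simp only [K, Set.mem_iInter, Set.mem_ofPred_eq]
      intro i U V h
      rw [LinearEquiv.symm_apply_apply, Al.map_ev]
    · simp only [C, Set.mem_ofPred_eq]
      rw [← hba, map_sum, map_sum]
      refine Finset.sum_congr rfl fun i _ => ?_
      rw [LinearEquiv.symm_apply_apply, smul_eq_mul, map_mul (Al.ev A U)]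
  have : Nonempty (OpenNormalSubgroup H) := ⟨topOpen H⟩
  obtain ⟨f, hf⟩ := IsCompact.nonempty_iInter_of_directed_nonempty_isCompact_isClosed
    (fun U => K ∩ C U)
    (fun U V => ⟨U ⊓ V, hmono inf_le_left, hmono inf_le_right⟩) hne
    (fun U => (hK.inter (hC U)).isCompact) (fun U => hK.inter (hC U))
  rw [Set.mem_iInter] at hf
  have hfK := (hf (topOpen H)).1
  simp only [K, Set.mem_iInter, Set.mem_ofPred_eq] at hfK
  refine Submodule.mem_span_finset'.2 ⟨fun i => ⟨fun U => (E U).symm (f i U), fun U V h => ?_⟩,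
    Al.ext_ev fun U => ?_⟩
  · change _ = (E V).symm (f i V)
    rw [← hfK i U V h, LinearEquiv.symm_apply_apply]
  · have h4 := (hf U).2
    apply (E U).injective
    rw [map_sum, map_sum]
    exact h4

end Closedness

/-! ### Generators of the powers of the augmentation ideal -/

section Structure

variable {A : Type*} [CommRing A] {H : Type*} [Group H] [TopologicalSpace H]

/-- `H` is topologically generated by the family `x`: the images of `x` generate all the quotients
by open normal subgroups. -/
def TopGenerates {J : Type*} (x : J → H) : Prop :=
  ∀ U : OpenNormalSubgroup H,
    Subgroup.closure (Set.range fun j => (QuotientGroup.mk (x j) : H ⧸ U.toSubgroup)) = ⊤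

variable {J : Type*} {x : J → H}

theorem monomial_append (w w' : List J) :
    monomial A x (w ++ w') = monomial A x w * monomial A x w' := by
  simp [monomial]

theorem monomial_singleton (j : J) : monomial A x [j] = Al.of A (x j) - 1 := by
  simp [monomial]

theorem of_sub_one_mem_ker_aug (g : H) : Al.of A g - 1 ∈ RingHom.ker (aug A H) := by
  rw [RingHom.mem_ker, map_sub, aug_of, map_one, sub_self]

/-- The augmentation ideal is generated, as an abstract left ideal, by the `x_j - 1`: this holds in
all the `A[H / U]`, and the left ideal on the right is closed. -/
theorem ker_aug_eq_span {p : ℕ} (hA : IsCoeffRing p A) [IsTopologicalGroup H] [CompactSpace H]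
    [Finite J] (hx : TopGenerates x) :
    RingHom.ker (aug A H) = Ideal.span (Set.range fun j => Al.of A (x j) - 1) := by
  apply le_antisymm
  · intro a ha
    refine hA.mem_of_forall_ev (Submodule.fg_span (Set.finite_range _)) fun U => ?_
    let I : Ideal (Al A H) := Ideal.span (Set.range fun j => Al.of A (x j) - 1)
    let N : Submodule A (MonoidAlgebra A (H ⧸ U.toSubgroup)) :=
      (I.restrictScalars A).map (Al.ev A U).toLinearMap
    change Al.ev A U a ∈ N
    have hmul : ∀ (g : H ⧸ U.toSubgroup), ∀ b ∈ N, MonoidAlgebra.of A _ g * b ∈ N := by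
      rintro g _ ⟨b, hb, rfl⟩
      obtain ⟨g, rfl⟩ := QuotientGroup.mk_surjective g
      refine ⟨Al.of A g * b, I.mul_mem_left _ hb, ?_⟩
      change Al.ev A U (Al.of A g * b) = _
      rw [map_mul, Al.ev_of]
      rfl
    refine mem_of_augP_eq_zero N (fun g => ?_) (by rw [Al.augP_ev]; exact ha)
    have hg : g ∈ Subgroup.closure
        (Set.range fun j => (QuotientGroup.mk (x j) : H ⧸ U.toSubgroup)) := by
      rw [hx U]
      exact Subgroup.mem_top g
    induction hg using Subgroup.closure_induction with
    | mem g hg =>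
      obtain ⟨j, rfl⟩ := hg
      exact ⟨Al.of A (x j) - 1, Ideal.subset_span ⟨j, rfl⟩, rfl⟩
    | one => rw [map_one, sub_self]; exact N.zero_mem
    | mul g h _ _ hg hh =>
      have e : MonoidAlgebra.of A _ (g * h) - 1 = MonoidAlgebra.of A _ g *
          (MonoidAlgebra.of A _ h - 1) + (MonoidAlgebra.of A _ g - 1) := by
        rw [map_mul]; noncomm_ring
      rw [e]
      exact N.add_mem (hmul g _ hh) hg
    | inv g _ hg =>
      have e : MonoidAlgebra.of A _ g⁻¹ - 1 = -(MonoidAlgebra.of A _ g⁻¹ *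
          (MonoidAlgebra.of A _ g - 1)) := by
        rw [mul_sub, ← map_mul, inv_mul_cancel, map_one, mul_one, neg_sub]
      rw [e]
      exact N.neg_mem (hmul _ _ hg)
  · rw [Ideal.span_le]
    rintro _ ⟨j, rfl⟩
    exact of_sub_one_mem_ker_aug (x j)

theorem AlIdeal_zero : AlIdeal A H 0 = ⊤ := by
  rw [AlIdeal, Submodule.pow_zero, Ideal.one_eq_top]

theorem AlIdeal_one : AlIdeal A H 1 = RingHom.ker (aug A H) := Submodule.pow_one _

theorem AlIdeal_mul_mem_right (n : ℕ) {a : Al A H} (ha : a ∈ AlIdeal A H n) (b : Al A H) :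
    a * b ∈ AlIdeal A H n := by
  have : (AlIdeal A H n).IsTwoSided := by
    rw [AlIdeal]
    infer_instance
  exact Ideal.mul_mem_right b _ ha

theorem AlIdeal_mul_mem {m n : ℕ} {a b : Al A H} (ha : a ∈ AlIdeal A H m)
    (hb : b ∈ AlIdeal A H n) : a * b ∈ AlIdeal A H (m + n) := by
  induction n generalizing b with
  | zero => exact AlIdeal_mul_mem_right m ha b
  | succ n ih =>
    rw [AlIdeal, Submodule.pow_succ] at hb
    refine Submodule.smul_induction_on hb (fun y hy z hz => ?_) (fun y z hy hz => ?_)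
    · rw [smul_eq_mul, ← mul_assoc, ← add_assoc, AlIdeal, Submodule.pow_succ]
      exact Ideal.mul_mem_mul (ih hy) hz
    · rw [mul_add]
      exact Ideal.add_mem _ hy hz

theorem AlIdeal_succ_le (n : ℕ) : AlIdeal A H (n + 1) ≤ AlIdeal A H n := by
  intro a ha
  rw [AlIdeal, Submodule.pow_succ] at ha
  refine Submodule.smul_induction_on ha (fun y hy z _ => ?_) (fun y z hy hz => ?_)
  · exact AlIdeal_mul_mem_right n hy z
  · exact Ideal.add_mem _ hy hz

theorem AlFil_antitone : Antitone (AlFil A H) :=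
  antitone_nat_of_succ_le fun n => AlIdeal_succ_le n

theorem monomial_mem_AlIdeal (w : List J) : monomial A x w ∈ AlIdeal A H w.length := by
  induction w with
  | nil => rw [List.length_nil, AlIdeal_zero]; exact Submodule.mem_top
  | cons j w ih =>
    have h := monomial_append (A := A) (x := x) [j] w
    rw [List.singleton_append] at h
    rw [h, monomial_singleton, List.length_cons, add_comm]
    refine AlIdeal_mul_mem ?_ ih
    rw [AlIdeal_one]
    exact of_sub_one_mem_ker_aug (x j)

theorem span_monomial_le_AlIdeal (n : ℕ) :
    Ideal.span (monomial A x '' {w | w.length = n}) ≤ AlIdeal A H n := by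
  rw [Ideal.span_le]
  rintro _ ⟨w, hw, rfl⟩
  rw [← (show w.length = n from hw)]
  exact monomial_mem_AlIdeal w

/-- The powers of the augmentation ideal are finitely generated as left ideals. -/
theorem AlIdeal_eq_span {p : ℕ} (hA : IsCoeffRing p A) [IsTopologicalGroup H] [CompactSpace H]
    [Finite J] (hx : TopGenerates x) (n : ℕ) :
    AlIdeal A H n = Ideal.span (monomial A x '' {w | w.length = n}) := by
  apply le_antisymm
  · induction n with
    | zero =>
      rw [AlIdeal_zero]
      refine ((Ideal.eq_top_iff_one _).2 (Ideal.subset_span ?_)).ge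
      exact ⟨[], rfl, by simp [monomial]⟩
    | succ n ih =>
      have key : ∀ z ∈ Ideal.span (Set.range fun j => Al.of A (x j) - 1),
          ∀ y ∈ Ideal.span (monomial A x '' {w | w.length = n}),
            y * z ∈ Ideal.span (monomial A x '' {w | w.length = n + 1}) := by
        intro z hz
        induction hz using Submodule.span_induction with
        | mem z hz =>
          obtain ⟨j, rfl⟩ := hz
          intro y hy
          induction hy using Submodule.span_induction with
          | mem y hy =>
            obtain ⟨w, hw, rfl⟩ := hy
            refine Ideal.subset_span ⟨w ++ [j], ?_, ?_⟩
            · rw [Set.mem_ofPred_eq, List.length_append, (show w.length = n from hw)]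
              rfl
            · rw [monomial_append, monomial_singleton]
          | zero => rw [zero_mul]; exact Ideal.zero_mem _
          | add y y' _ _ hy hy' =>
            rw [add_mul]
            exact Ideal.add_mem _ hy hy'
          | smul c y _ hy =>
            rw [smul_eq_mul, mul_assoc]
            exact Ideal.mul_mem_left _ c hy
        | zero => intro y _; rw [mul_zero]; exact Ideal.zero_mem _
        | add z z' _ _ hz hz' =>
          intro y hy
          rw [mul_add]
          exact Ideal.add_mem _ (hz y hy) (hz' y hy)
        | smul c z _ hz =>
          intro y hy
          rw [smul_eq_mul, ← mul_assoc]
          exact hz _ (ih (AlIdeal_mul_mem_right n (span_monomial_le_AlIdeal n hy) c))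
      intro a ha
      rw [AlIdeal, Submodule.pow_succ] at ha
      refine Submodule.smul_induction_on ha (fun y hy z hz => ?_) (fun y z hy hz => ?_)
      · rw [ker_aug_eq_span hA hx] at hz
        exact key z hz y (ih hy)
      · exact Ideal.add_mem _ hy hz
  · exact span_monomial_le_AlIdeal n

theorem AlFil_le_span_sup_succ {p : ℕ} (hA : IsCoeffRing p A) [IsTopologicalGroup H]
    [CompactSpace H] [Finite J] (hx : TopGenerates x) (n : ℕ) :
    AlFil A H n ≤ Submodule.span A (monomial A x '' {w | w.length = n}) ⊔ AlFil A H (n + 1) := by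
  intro a ha
  have ha' : a ∈ AlIdeal A H n := ha
  rw [AlIdeal_eq_span hA hx] at ha'
  obtain ⟨f, hf⟩ := Submodule.mem_span_set.1 ha'
  rw [← hf.2]
  refine Submodule.sum_mem _ fun v hv => ?_
  obtain ⟨w, hw, rfl⟩ := hf.1 hv
  have hw' : w.length = n := hw
  have e : f (monomial A x w) • monomial A x w =
      aug A H (f (monomial A x w)) • monomial A x w +
      (f (monomial A x w) - algebraMap A _ (aug A H (f (monomial A x w)))) * monomial A x w := by
    rw [smul_eq_mul, sub_mul, ← Algebra.smul_def, add_sub_cancel]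
  change f (monomial A x w) • monomial A x w ∈ _
  rw [e]
  refine Submodule.add_mem_sup
    (Submodule.smul_mem _ _ (Submodule.subset_span ⟨w, hw, rfl⟩)) ?_
  change _ ∈ AlIdeal A H (n + 1)
  rw [add_comm]
  refine AlIdeal_mul_mem ?_ (hw' ▸ monomial_mem_AlIdeal w)
  rw [AlIdeal_one, RingHom.mem_ker, map_sub, AlgHom.commutes, Algebra.algebraMap_self_apply,
    sub_self]

theorem AlFil_le_span_sup {p : ℕ} (hA : IsCoeffRing p A) [IsTopologicalGroup H]
    [CompactSpace H] [Finite J] (hx : TopGenerates x) (n N : ℕ) (h : n ≤ N) :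
    AlFil A H n ≤
      Submodule.span A (monomial A x '' {w | n ≤ w.length ∧ w.length < N}) ⊔ AlFil A H N := by
  induction N, h using Nat.le_induction with
  | base => exact le_sup_right
  | succ N hN ih =>
    refine ih.trans (sup_le ?_ ?_)
    · refine (Submodule.span_mono (Set.image_mono fun w hw => ?_)).trans le_sup_left
      exact ⟨hw.1, hw.2.trans N.lt_succ_self⟩
    · refine (AlFil_le_span_sup_succ hA hx N).trans (sup_le_sup_right
        (Submodule.span_mono (Set.image_mono fun w hw => ?_)) _)
      have hw' : w.length = N := hw
      exact ⟨by omega, by omega⟩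

theorem AlFil_zero : AlFil A H 0 = ⊤ := by
  rw [AlFil, AlIdeal_zero]
  rfl

theorem finite_quotient_AlFil {p : ℕ} (hA : IsCoeffRing p A) [IsTopologicalGroup H]
    [CompactSpace H] [Finite J] (hx : TopGenerates x) (N : ℕ) :
    Module.Finite A (Al A H ⧸ AlFil A H N) := by
  have h := AlFil_le_span_sup hA hx 0 N (Nat.zero_le N)
  rw [AlFil_zero] at h
  refine ⟨?_⟩
  have h1 := congrArg (Submodule.map (AlFil A H N).mkQ) (top_le_iff.1 h)
  rw [Submodule.map_sup, Submodule.mkQ_map_self, sup_bot_eq, Submodule.map_top,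
    Submodule.range_mkQ] at h1
  rw [← h1]
  refine (Submodule.fg_span (Set.Finite.image _ ?_)).map _
  exact (List.finite_length_lt J N).subset fun w hw => hw.2

variable {p : ℕ} [Fact p.Prime]

/-- Modulo a power of `p`, the powers of the augmentation ideal are open. -/
theorem exists_open_le_AlFil (hA : IsCoeffRing p A) [IsTopologicalGroup H]
    [CompactSpace H] [Finite J] (hx : TopGenerates x) (N k : ℕ) :
    ∃ U : OpenNormalSubgroup H, ∀ a : Al A H, Al.ev A U a = 0 →
      ∃ b, a - (p : A) ^ k • b ∈ AlFil A H N := by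
  let C : Ideal (Al A H) := AlIdeal A H N ⊔ Ideal.span {(p : Al A H) ^ k}
  have hpC : ∀ b : Al A H, (p : A) ^ k • b ∈ C := by
    intro b
    refine Ideal.mem_sup_right (Ideal.mem_span_singleton'.2 ⟨b, ?_⟩)
    rw [← Nat.cast_pow, ← Nat.cast_pow, Nat.cast_smul_eq_nsmul, nsmul_eq_mul, Nat.cast_comm]
  have hC : C.FG := by
    refine Submodule.FG.sup ?_ (Submodule.fg_span_singleton _)
    rw [AlIdeal_eq_span hA hx]
    exact Submodule.fg_span ((List.finite_length_eq J N).image _)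
  let C' : Submodule A (Al A H) := C.restrictScalars A
  have hfin : Finite (Al A H ⧸ C') := by
    have := finite_quotient_AlFil hA hx N
    have hle : AlFil A H N ≤ C' := fun a ha => Ideal.mem_sup_left ha
    have : Module.Finite A (Al A H ⧸ C') :=
      Module.Finite.of_surjective (Submodule.factor hle) (Submodule.factor_surjective hle)
    refine hA.finite_of_pow_smul (k := k) fun v => ?_
    obtain ⟨v, rfl⟩ := C'.mkQ_surjective v
    rw [← map_smul]
    exact (Submodule.Quotient.mk_eq_zero C').2 (hpC v)
  -- the image of the kernel of `Al(A, H) → A[H / U]` in this finite quotient; the smallest of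
  -- these images vanishes since `C` is closed
  let T (U : OpenNormalSubgroup H) : Submodule A (Al A H ⧸ C') :=
    (LinearMap.ker (Al.ev A U).toLinearMap).map C'.mkQ
  obtain ⟨U, hU⟩ : ∃ U, ∀ V, Nat.card (T U) ≤ Nat.card (T V) := by
    have hne : (Set.range fun U => Nat.card (T U)).Nonempty := ⟨_, topOpen H, rfl⟩
    obtain ⟨U, hU⟩ := Nat.sInf_mem hne
    exact ⟨U, fun V => (show Nat.card (T U) = _ from hU).le.trans (Nat.sInf_le ⟨V, rfl⟩)⟩
  have hmono {U V : OpenNormalSubgroup H} (h : U.toSubgroup ≤ V.toSubgroup) : T U ≤ T V := by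
    refine Submodule.map_mono fun a ha => ?_
    have ha' : Al.ev A U a = 0 := ha
    change Al.ev A V a = 0
    rw [← Al.map_ev h, ha', map_zero]
  have hle (V) : T U ≤ T V := by
    have h1 : T (U ⊓ V) ≤ T U := hmono inf_le_left
    have h2 : (T (U ⊓ V) : Set (Al A H ⧸ C')) = T U :=
      Set.eq_of_subset_of_ncard_le (SetLike.coe_subset_coe.2 h1) (hU (U ⊓ V)) (Set.toFinite _)
    rw [← SetLike.coe_set_eq.1 h2]
    exact hmono inf_le_right
  refine ⟨U, fun a ha => ?_⟩
  have haC : a ∈ C := by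
    refine hA.mem_of_forall_ev hC fun V => ?_
    obtain ⟨b, hb, hab⟩ := hle V (⟨a, ha, rfl⟩ : C'.mkQ a ∈ T U)
    have hb' : Al.ev A V b = 0 := hb
    refine ⟨a - b, ?_, by rw [map_sub, hb', sub_zero]⟩
    exact (Submodule.Quotient.eq C').1 hab.symm
  obtain ⟨b, hb, c, hc, rfl⟩ := Submodule.mem_sup.1 haC
  obtain ⟨d, rfl⟩ := Ideal.mem_span_singleton'.1 hc
  refine ⟨d, ?_⟩
  rw [← Nat.cast_pow, ← Nat.cast_pow, Nat.cast_smul_eq_nsmul, nsmul_eq_mul, Nat.cast_comm,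
    add_sub_cancel_right]
  exact hb

/-- In the group algebra of a finite quotient, the powers of the augmentation ideal tend to zero
`p`-adically. -/
theorem exists_ev_AlFil_eq_smul (hA : IsCoeffRing p A) [IsTopologicalGroup H] [CompactSpace H]
    (hH : IsProP p H) (U : OpenNormalSubgroup H) (k : ℕ) :
    ∃ N, ∀ a ∈ AlFil A H N, ∃ b, Al.ev A U a = (p : A) ^ k • b := by
  obtain ⟨N, hN⟩ := exists_pow_ker_augP_le hA (hH U) k
  refine ⟨N, fun a ha => hN _ ?_⟩
  have ha' : a ∈ AlIdeal A H N := ha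
  clear ha hN
  induction N generalizing a with
  | zero =>
    rw [Submodule.pow_zero, Ideal.one_eq_top]
    exact Submodule.mem_top
  | succ N ih =>
    rw [AlIdeal, Submodule.pow_succ] at ha'
    rw [Submodule.pow_succ]
    refine Submodule.smul_induction_on ha' (fun y hy z hz => ?_) (fun y z hy hz => ?_)
    · rw [smul_eq_mul, map_mul]
      refine Ideal.mul_mem_mul (ih y hy) ?_
      rw [RingHom.mem_ker] at hz ⊢
      rw [Al.augP_ev, hz]
    · rw [map_add]
      exact Ideal.add_mem _ hy hz

end Structure

/-! ### Topological generation -/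

section Generation

variable {p : ℕ} [Fact p.Prime] {F : Type*} [Group F] [TopologicalSpace F]
  {G : Type*} [Group G] [TopologicalSpace G] {J : Type*} {x : J → F}

/-- A free family generates topologically: otherwise its image in some finite quotient lies in a
maximal subgroup, which is normal, and the quotient by it gives two homomorphisms that agree on
the family. -/
theorem IsFreeProP.topGenerates [IsTopologicalGroup F] [CompactSpace F] (hF : IsProP p F)
    (hx : IsFreeProP p x) : TopGenerates x := by
  intro U
  by_contra hne
  let P := F ⧸ U.toSubgroup
  obtain ⟨M, hM, hle⟩ := (eq_top_or_exists_le_coatom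
    (Subgroup.closure (Set.range fun j => (QuotientGroup.mk (x j) : P)))).resolve_left hne
  have : Group.IsNilpotent P := (hF U).isNilpotent
  have hMn : M.Normal := Subgroup.NormalizerCondition.normal_of_coatom M
    Group.normalizerCondition_of_isNilpotent hM
  let e : Shrink.{0} (P ⧸ M) ≃* (P ⧸ M) := Shrink.mulEquiv
  have hp : IsPGroup p (Shrink.{0} (P ⧸ M)) := ((hF U).to_quotient M).of_equiv e.symm
  let φ : F →* Shrink.{0} (P ⧸ M) :=
    (e.symm : (P ⧸ M) →* _).comp ((QuotientGroup.mk' M).comp (QuotientGroup.mk' U.toSubgroup))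
  have hφ : ∀ f, φ f = 1 ↔ (QuotientGroup.mk f : P) ∈ M := by
    intro f
    rw [← QuotientGroup.eq_one_iff (N := M)]
    exact e.symm.map_eq_one_iff
  have hφo : IsOpen (φ.ker : Set F) := by
    refine Subgroup.isOpen_mono (H₁ := U.toSubgroup) (fun f hf => ?_) U.isOpen'
    rw [MonoidHom.mem_ker, hφ, (QuotientGroup.eq_one_iff f).2 hf]
    exact M.one_mem
  obtain ⟨ψ, -, hψ⟩ := hx (Shrink.{0} (P ⧸ M)) hp (fun _ => 1)
  have h1 : φ = ψ := hψ φ ⟨hφo, fun j => (hφ _).2 (hle (Subgroup.subset_closure ⟨j, rfl⟩))⟩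
  have h2 : 1 = ψ := hψ 1 ⟨by rw [MonoidHom.ker_one]; exact isOpen_univ, fun _ => rfl⟩
  refine hM.1 (top_le_iff.1 fun f _ => ?_)
  obtain ⟨f, rfl⟩ := QuotientGroup.mk_surjective f
  rw [← hφ, h1, ← h2, MonoidHom.one_apply]

theorem TopGenerates.map (hx : TopGenerates x) (π : F →* G) (hπ : Continuous π)
    (hsurj : Function.Surjective π) : TopGenerates fun j => π (x j) := by
  intro U
  have hs : Function.Surjective (quotMap π hπ U) := by
    intro g
    obtain ⟨g, rfl⟩ := QuotientGroup.mk_surjective g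
    obtain ⟨f, rfl⟩ := hsurj g
    exact ⟨QuotientGroup.mk f, rfl⟩
  have h := congrArg (Subgroup.map (quotMap π hπ U)) (hx (comapOpen π hπ U))
  rw [MonoidHom.map_closure, ← Set.range_comp, Subgroup.map_top_of_surjective _ hs] at h
  exact h

end Generation

/-! ### The weight filtration -/

section Weights

theorem Al.ev_surjective {A : Type*} [CommRing A] {H : Type*} [Group H] [TopologicalSpace H]
    (U : OpenNormalSubgroup H) : Function.Surjective (Al.ev A U) := by
  intro b
  induction b using MonoidAlgebra.induction_on with
  | of g =>
    obtain ⟨g, rfl⟩ := QuotientGroup.mk_surjective g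
    exact ⟨Al.of A g, rfl⟩
  | add b c hb hc =>
    obtain ⟨b, rfl⟩ := hb
    obtain ⟨c, rfl⟩ := hc
    exact ⟨b + c, map_add _ _ _⟩
  | smul r b hb =>
    obtain ⟨b, rfl⟩ := hb
    exact ⟨r • b, map_smul _ _ _⟩

variable {A : Type*} [CommRing A] {H : Type*} [Group H] [TopologicalSpace H]
  {J : Type*} {x : J → H} {wt : J → ℕ}

theorem wordWeight_append (w w' : List J) :
    wordWeight wt (w ++ w') = wordWeight wt w + wordWeight wt w' := by
  simp [wordWeight]

theorem length_le_wordWeight (hwt : ∀ j, 1 ≤ wt j) (w : List J) : w.length ≤ wordWeight wt w := by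
  induction w with
  | nil => exact Nat.zero_le _
  | cons j w ih =>
    have := hwt j
    rw [List.length_cons, wordWeight, List.map_cons, List.sum_cons]
    rw [wordWeight] at ih
    omega

theorem wordWeight_le {q : ℕ} (hwt : ∀ j, wt j ≤ q) (w : List J) :
    wordWeight wt w ≤ q * w.length := by
  induction w with
  | nil => exact Nat.zero_le _
  | cons j w ih =>
    have := hwt j
    rw [List.length_cons, wordWeight, List.map_cons, List.sum_cons, Nat.mul_succ]
    rw [wordWeight] at ih
    omega

variable (A x wt) in
/-- The span of the monomials of weight at least `m`. -/
def wtSpan (m : ℕ) : Submodule A (Al A H) :=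
  Submodule.span A (monomial A x '' {w | m ≤ wordWeight wt w})

variable (A x wt) in
/-- The weight filtration on the completed group algebra of a group generated by the family `x`:
the elements that are congruent to combinations of monomials of weight at least `m` modulo the
`m`-th power of the augmentation ideal. The latter may be replaced by any higher power, see
`wtFil_eq_sup`. -/
def wtFil (m : ℕ) : Submodule A (Al A H) := wtSpan A x wt m ⊔ AlFil A H m

theorem monomial_mem_wtSpan {m : ℕ} {w : List J} (h : m ≤ wordWeight wt w) :
    monomial A x w ∈ wtSpan A x wt m := Submodule.subset_span ⟨w, h, rfl⟩

theorem wtSpan_antitone : Antitone (wtSpan A x wt) := fun _ _ h =>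
  Submodule.span_mono (Set.image_mono fun _ hw => h.trans hw)

theorem wtFil_antitone : Antitone (wtFil A x wt) := fun _ _ h =>
  sup_le_sup (wtSpan_antitone h) (AlFil_antitone h)

variable {p : ℕ} [IsTopologicalGroup H] [CompactSpace H] [Finite J]

theorem AlFil_le_wtSpan_sup (hA : IsCoeffRing p A) (hx : TopGenerates x) (hwt : ∀ j, 1 ≤ wt j)
    {m N : ℕ} (h : m ≤ N) : AlFil A H m ≤ wtSpan A x wt m ⊔ AlFil A H N := by
  refine (AlFil_le_span_sup hA hx m N h).trans (sup_le_sup_right (Submodule.span_mono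
    (Set.image_mono fun w hw => ?_)) _)
  exact hw.1.trans (length_le_wordWeight hwt w)

theorem wtFil_eq_sup (hA : IsCoeffRing p A) (hx : TopGenerates x) (hwt : ∀ j, 1 ≤ wt j)
    {m N : ℕ} (h : m ≤ N) : wtFil A x wt m = wtSpan A x wt m ⊔ AlFil A H N :=
  le_antisymm (sup_le le_sup_left (AlFil_le_wtSpan_sup hA hx hwt h))
    (sup_le_sup_left (AlFil_antitone h) _)

theorem finite_quotient_of_AlFil_le (hA : IsCoeffRing p A) (hx : TopGenerates x)
    {N : ℕ} {V : Submodule A (Al A H)} (h : AlFil A H N ≤ V) : Module.Finite A (Al A H ⧸ V) := by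
  have := finite_quotient_AlFil hA hx N
  exact Module.Finite.of_surjective (Submodule.factor h) (Submodule.factor_surjective h)

/-- Expansion of an element in a noncommutative power series, degree by degree. -/
theorem exists_coeff_sub_sum_mem (hA : IsCoeffRing p A) (hx : TopGenerates x) {m : ℕ}
    {a : Al A H} (ha : a ∈ AlFil A H m) :
    ∃ s : List J → A, (∀ w, s w ≠ 0 → m ≤ w.length) ∧
      ∀ N, ∃ S₀ : Finset (List J), ∀ S : Finset (List J), S₀ ⊆ S →
        a - ∑ w ∈ S, s w • monomial A x w ∈ AlFil A H (m + N) := by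
  classical
  have key : ∀ n (r : AlFil A H n), ∃ c : List J →₀ A, (∀ w, w.length ≠ n → c w = 0) ∧
      (r : Al A H) - Finsupp.linearCombination A (monomial A x) c ∈ AlFil A H (n + 1) := by
    intro n r
    obtain ⟨u, hu, v, hv, huv⟩ := Submodule.mem_sup.1 (AlFil_le_span_sup_succ hA hx n r.2)
    obtain ⟨c, hc, rfl⟩ := (Finsupp.mem_span_image_iff_linearCombination A).1 hu
    refine ⟨c, fun w hw => ?_, ?_⟩
    · by_contra h0
      exact hw ((Finsupp.mem_supported A c).1 hc (Finsupp.mem_support_iff.2 h0))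
    · rw [← huv, add_sub_cancel_left]
      exact hv
  choose c hc1 hc2 using key
  let R : ∀ i, AlFil A H (m + i) := fun i => Nat.rec ⟨a, ha⟩
    (fun i r => ⟨(r : Al A H) - Finsupp.linearCombination A (monomial A x) (c _ r), hc2 _ r⟩) i
  let C : ℕ → (List J →₀ A) := fun N => ∑ i ∈ Finset.range N, c (m + i) (R i)
  have hR : ∀ N, a = Finsupp.linearCombination A (monomial A x) (C N) + (R N).1 := by
    intro N
    induction N with
    | zero => simp [C, R]
    | succ N ih =>
      have e1 : C (N + 1) = C N + c (m + N) (R N) := Finset.sum_range_succ _ _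
      have e2 : (R (N + 1)).1 =
        (R N).1 - Finsupp.linearCombination A (monomial A x) (c (m + N) (R N)) := rfl
      rw [e1, e2, map_add, add_assoc, add_sub_cancel]
      exact ih
  let s : List J → A := fun w => if m ≤ w.length then c _ (R (w.length - m)) w else 0
  have hs : ∀ N w, w.length < m + N → C N w = s w := by
    intro N w hw
    simp only [C, s, Finsupp.finsetSum_apply]
    split_ifs with h
    · rw [Finset.sum_eq_single (w.length - m)]
      · intro i _ hi
        exact hc1 _ _ _ (by omega)
      · intro hi
        exact absurd (Finset.mem_range.2 (by omega)) hi
    · exact Finset.sum_eq_zero fun i _ => hc1 _ _ _ (by omega)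
  refine ⟨s, fun w hw => ?_, fun N => ⟨(C N).support, fun S hS => ?_⟩⟩
  · by_contra h
    exact hw (if_neg h)
  · have e : a - ∑ w ∈ S, s w • monomial A x w =
        (R N).1 - ∑ w ∈ S, (s w - C N w) • monomial A x w := by
      have hsum : Finsupp.linearCombination A (monomial A x) (C N) =
          ∑ w ∈ S, C N w • monomial A x w := by
        rw [Finsupp.linearCombination_apply]
        exact Finsupp.sum_of_support_subset _ hS _ fun _ _ => zero_smul A _
      conv_lhs => rw [hR N, hsum]
      simp only [sub_smul, Finset.sum_sub_distrib]
      abel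
    rw [e]
    refine sub_mem (R N).2 (Submodule.sum_mem _ fun w _ => ?_)
    by_cases hw : w.length < m + N
    · rw [hs N w hw, sub_self, zero_smul]
      exact Submodule.zero_mem _
    · exact Submodule.smul_mem _ _ (AlFil_antitone (not_lt.1 hw) (monomial_mem_AlIdeal w))

variable [Fact p.Prime]

/-- The elements represented by series of weight at least `m` are those congruent to combinations of
finitely many monomials of weight at least `m`, modulo a power of the augmentation ideal. -/
theorem serFil_eq_wtFil (hA : IsCoeffRing p A) (hH : IsProP p H) (hx : TopGenerates x)
    (hwt : ∀ j, 1 ≤ wt j) (m : ℕ) : serFil p A x wt m = wtFil A x wt m := by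
  classical
  apply le_antisymm
  · rintro a ⟨s, hs, hsa⟩
    have hfin : Module.Finite A (Al A H ⧸ wtFil A x wt m) :=
      finite_quotient_of_AlFil_le hA hx le_sup_right
    refine hA.mem_of_forall_pow (wtFil A x wt m) fun k => ?_
    obtain ⟨U, hU⟩ := exists_open_le_AlFil hA hx m k
    obtain ⟨S, hS⟩ := hsa U k
    obtain ⟨b, hb⟩ := hS S subset_rfl
    obtain ⟨b, rfl⟩ := Al.ev_surjective U b
    have hb' : Al.ev A U (a - ∑ w ∈ S, s w • monomial A x w) = (p : A) ^ k • Al.ev A U b := hb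
    obtain ⟨b', hb'⟩ := hU (a - ∑ w ∈ S, s w • monomial A x w - (p : A) ^ k • b)
      (by rw [map_sub, hb', map_smul, sub_self])
    refine ⟨b + b', ?_⟩
    have e : a - (p : A) ^ k • (b + b') = ∑ w ∈ S, s w • monomial A x w +
        (a - ∑ w ∈ S, s w • monomial A x w - (p : A) ^ k • b - (p : A) ^ k • b') := by
      rw [smul_add]
      abel
    rw [e]
    refine Submodule.add_mem_sup (Submodule.sum_mem _ fun w _ => ?_) hb'
    by_cases hw : s w = 0
    · rw [hw, zero_smul]
      exact Submodule.zero_mem _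
    · exact Submodule.smul_mem _ _ (monomial_mem_wtSpan (hs w hw))
  · refine sup_le (Submodule.span_le.2 ?_) fun a ha => ?_
    · rintro _ ⟨w, hw, rfl⟩
      refine ⟨Pi.single w 1, fun w' hw' => ?_, fun U k => ⟨{w}, fun S hS => ⟨0, ?_⟩⟩⟩
      · by_cases h : w' = w
        · exact h ▸ hw
        · exact absurd (Pi.single_eq_of_ne h _) hw'
      · have e : ∑ w' ∈ S, (Pi.single w 1 : List J → A) w' • monomial A x w' =
            monomial A x w := by
          rw [Finset.sum_eq_single w]
          · rw [Pi.single_eq_same, one_smul]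
          · intro w' _ h
            rw [Pi.single_eq_of_ne h, zero_smul]
          · intro h
            exact absurd (hS (Finset.mem_singleton_self w)) h
        rw [e, sub_self, smul_zero]
        rfl
    · obtain ⟨s, hs, hsa⟩ := exists_coeff_sub_sum_mem hA hx ha
      refine ⟨s, fun w hw => (hs w hw).trans (length_le_wordWeight hwt w), fun U k => ?_⟩
      obtain ⟨N, hN⟩ := exists_ev_AlFil_eq_smul hA hH U k
      obtain ⟨S₀, hS₀⟩ := hsa N
      exact ⟨S₀, fun S hS => hN _ (AlFil_antitone (Nat.le_add_left N m) (hS₀ S hS))⟩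

end Weights

/-! ### The ideal of relations -/

section Kernel

variable {A : Type*} [CommRing A]

/-- The kernel of `A[P] → A[P']`, for a homomorphism `f : P → P'`, is spanned by the `g k - g`
with `k` in the kernel of `f`. -/
theorem mem_of_mapDomain_eq_zero {P P' : Type*} [Group P] [Group P'] (f : P →* P')
    (N : Submodule A (MonoidAlgebra A P))
    (hN : ∀ g, ∀ k ∈ f.ker, MonoidAlgebra.of A P (g * k) - MonoidAlgebra.of A P g ∈ N)
    {y : MonoidAlgebra A P} (hy : MonoidAlgebra.mapDomainAlgHom A A f y = 0) : y ∈ N := by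
  let σ : P' → P := Function.invFun f
  let L : MonoidAlgebra A P' →ₗ[A] MonoidAlgebra A P :=
    (MonoidAlgebra.coeffLinearEquiv A).symm.toLinearMap ∘ₗ Finsupp.lmapDomain A A σ ∘ₗ
      (MonoidAlgebra.coeffLinearEquiv A).toLinearMap
  have hL : ∀ h, L (MonoidAlgebra.of A P' h) = MonoidAlgebra.of A P (σ h) := by
    intro h
    apply MonoidAlgebra.coeff_injective
    change Finsupp.mapDomain σ (Finsupp.single h 1) = Finsupp.single (σ h) 1
    exact Finsupp.mapDomain_single
  have key : ∀ y : MonoidAlgebra A P, y - L (MonoidAlgebra.mapDomainAlgHom A A f y) ∈ N := by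
    intro y
    induction y using MonoidAlgebra.induction_on with
    | of g =>
      have e : MonoidAlgebra.mapDomainAlgHom A A f (MonoidAlgebra.of A P g) =
          MonoidAlgebra.of A P' (f g) := by simp
      rw [e, hL]
      have h1 : f (σ (f g)) = f g := Function.invFun_eq ⟨g, rfl⟩
      have h2 := hN (σ (f g)) ((σ (f g))⁻¹ * g)
        (by rw [MonoidHom.mem_ker, map_mul, map_inv, h1, inv_mul_cancel])
      rwa [mul_inv_cancel_left] at h2
    | add a b ha hb =>
      rw [map_add, map_add, add_sub_add_comm]
      exact N.add_mem ha hb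
    | smul r a ha =>
      rw [map_smul, map_smul, ← smul_sub]
      exact N.smul_mem r ha
  have := key y
  rwa [hy, map_zero, sub_zero] at this

variable {F : Type*} [Group F] [TopologicalSpace F] {G : Type*} [Group G] {π : F →* G}

variable (A π) in
/-- The ideal of relations, as an `A`-submodule. -/
def relSub : Submodule A (Al A F) := (relIdeal A π).restrictScalars A

theorem sub_one_mem_relSub {r : F} (hr : r ∈ π.ker) : Al.of A r - 1 ∈ relSub A π := by
  change _ ∈ relIdeal A π
  rw [relIdeal, TwoSidedIdeal.mem_asIdeal]
  exact TwoSidedIdeal.subset_span ⟨r, hr, rfl⟩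

variable [TopologicalSpace G]

theorem Al.map_of (hπ : Continuous π) (g : F) : Al.map A π hπ (Al.of A g) = Al.of A (π g) := by
  refine Al.ext_ev fun U => ?_
  change MonoidAlgebra.mapDomainAlgHom A A (quotMap π hπ U) (MonoidAlgebra.of A _ _) =
    MonoidAlgebra.of A _ _
  simp
  rfl

theorem Al.ev_map (hπ : Continuous π) (U : OpenNormalSubgroup G) (a : Al A F) :
    Al.ev A U (Al.map A π hπ a) =
      MonoidAlgebra.mapDomainAlgHom A A (quotMap π hπ U) (Al.ev A (comapOpen π hπ U) a) := rfl

theorem relSub_le_ker (hπ : Continuous π) :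
    relSub A π ≤ LinearMap.ker (Al.map A π hπ).toLinearMap := by
  intro a ha
  have ha' : a ∈ relIdeal A π := ha
  rw [relIdeal, TwoSidedIdeal.mem_asIdeal, TwoSidedIdeal.mem_span_iff] at ha'
  have h := ha' (TwoSidedIdeal.ker (Al.map A π hπ)) (by
    rintro _ ⟨r, hr, rfl⟩
    rw [SetLike.mem_coe, TwoSidedIdeal.mem_ker, map_sub, Al.map_of, map_one,
      MonoidHom.mem_ker.1 hr, map_one, sub_self])
  exact LinearMap.mem_ker.2 ((TwoSidedIdeal.mem_ker (Al.map A π hπ)).1 h)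

theorem Al.map_monomial (hπ : Continuous π) {J : Type*} (x : J → F) (w : List J) :
    Al.map A π hπ (monomial A x w) = monomial A (fun j => π (x j)) w := by
  rw [monomial, map_list_prod, List.map_map, monomial]
  congr 2
  funext j
  rw [Function.comp_apply, map_sub, Al.map_of, map_one]

theorem map_wtSpan (hπ : Continuous π) {J : Type*} (x : J → F) (wt : J → ℕ) (m : ℕ) :
    (wtSpan A x wt m).map (Al.map A π hπ).toLinearMap = wtSpan A (fun j => π (x j)) wt m := by
  rw [wtSpan, wtSpan, Submodule.map_span, ← Set.image_comp]
  congr 2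
  funext w
  exact Al.map_monomial hπ x w

theorem map_wtFil_le (hπ : Continuous π) {J : Type*} (x : J → F) (wt : J → ℕ) (m : ℕ) :
    (wtFil A x wt m).map (Al.map A π hπ).toLinearMap ≤ wtFil A (fun j => π (x j)) wt m := by
  rw [wtFil, Submodule.map_sup, map_wtSpan hπ]
  refine sup_le_sup_left ?_ _
  rintro _ ⟨a, ha, rfl⟩
  exact AlIdeal_map π hπ m a ha

theorem Al.ev_map_surjective (hπ : Continuous π) (hsurj : Function.Surjective π)
    (V : OpenNormalSubgroup G) (b : MonoidAlgebra A (G ⧸ V.toSubgroup)) :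
    ∃ c : Al A F, Al.ev A V (Al.map A π hπ c) = b := by
  induction b using MonoidAlgebra.induction_on with
  | of g =>
    obtain ⟨g, rfl⟩ := QuotientGroup.mk_surjective g
    obtain ⟨f, rfl⟩ := hsurj g
    exact ⟨Al.of A f, by rw [Al.map_of, Al.ev_of]⟩
  | add b c hb hc =>
    obtain ⟨b, rfl⟩ := hb
    obtain ⟨c, rfl⟩ := hc
    exact ⟨b + c, by rw [map_add, map_add]⟩
  | smul r b hb =>
    obtain ⟨b, rfl⟩ := hb
    exact ⟨r • b, by rw [map_smul, map_smul]⟩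

/-- The image of an open normal subgroup under a surjective continuous homomorphism of compact
groups. -/
def mapOpen [IsTopologicalGroup F] [CompactSpace F] [IsTopologicalGroup G] [T2Space G]
    (hπ : Continuous π) (hsurj : Function.Surjective π) (U : OpenNormalSubgroup F) :
    OpenNormalSubgroup G where
  toSubgroup := U.toSubgroup.map π
  isOpen' := by
    have : U.toSubgroup.FiniteIndex := Subgroup.finiteIndex_of_finite_quotient
    have : (U.toSubgroup.map π).FiniteIndex :=
      ⟨fun h => this.index_ne_zero (Nat.eq_zero_of_zero_dvd
        (h ▸ U.toSubgroup.index_map_dvd hsurj))⟩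
    have hc : IsClosed (U.toSubgroup.map π : Set G) :=
      ((U.toOpenSubgroup.isClosed).isCompact.image hπ).isClosed
    exact Subgroup.isOpen_of_isClosed_of_finiteIndex _ hc
  isNormal' := U.isNormal'.map π hsurj

variable {p : ℕ} [IsTopologicalGroup G] [CompactSpace G] {J : Type*} [Finite J] {x : J → F}

theorem map_wtFil_sup {wt : J → ℕ} (hA : IsCoeffRing p A) (hx : TopGenerates x)
    (hwt : ∀ j, 1 ≤ wt j) (hπ : Continuous π) (hsurj : Function.Surjective π) (m : ℕ) :
    (wtFil A x wt m).map (Al.map A π hπ).toLinearMap ⊔ wtFil A (fun j => π (x j)) wt (m + 1) =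
      wtFil A (fun j => π (x j)) wt m ⊔ wtFil A (fun j => π (x j)) wt (m + 1) := by
  apply le_antisymm
  · exact sup_le_sup_right (map_wtFil_le hπ x wt m) _
  · refine sup_le ?_ le_sup_right
    rw [wtFil_eq_sup hA (hx.map π hπ hsurj) hwt (Nat.le_succ m), ← map_wtSpan hπ x]
    exact sup_le_sup (Submodule.map_mono le_sup_left) le_sup_right

variable [Fact p.Prime] [IsTopologicalGroup F] [CompactSpace F] [T2Space G]

/-- The algebra `Al(A, F) / I(A, R)` and `Al(A, G)` agree modulo the powers of the augmentation
ideals, although `I(A, R)` need not be closed. -/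
theorem mem_AlFil_sup_relSub (hA : IsCoeffRing p A) (hx : TopGenerates x) (hG : IsProP p G)
    (hπ : Continuous π) (hsurj : Function.Surjective π) {N : ℕ} {a : Al A F}
    (ha : Al.map A π hπ a ∈ AlFil A G N) : a ∈ AlFil A F N ⊔ relSub A π := by
  have hfin : Module.Finite A (Al A F ⧸ (AlFil A F N ⊔ relSub A π)) :=
    finite_quotient_of_AlFil_le hA hx le_sup_left
  refine hA.mem_of_forall_pow (AlFil A F N ⊔ relSub A π) fun k => ?_
  obtain ⟨U, hU⟩ := exists_open_le_AlFil hA hx N k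
  let V := mapOpen hπ hsurj U
  let W := comapOpen π hπ V
  have hUW : U.toSubgroup ≤ W.toSubgroup := fun u hu => ⟨u, hu, rfl⟩
  obtain ⟨M, hM⟩ := exists_ev_AlFil_eq_smul hA hG V k
  -- an element of `Al_N(A, G)` is the image of one of `Al_N(A, F)` up to a high power
  obtain ⟨a', ha', haM⟩ : ∃ a' ∈ AlFil A F N, Al.map A π hπ (a - a') ∈ AlFil A G (max M N) := by
    obtain ⟨u, hu, v, hv, huv⟩ := Submodule.mem_sup.1
      (AlFil_le_span_sup hA (hx.map π hπ hsurj) N (max M N) (le_max_right _ _) ha)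
    have hle : Submodule.span A (monomial A (fun j => π (x j)) ''
        {w | N ≤ w.length ∧ w.length < max M N}) ≤
        (AlFil A F N).map (Al.map A π hπ).toLinearMap := by
      refine Submodule.span_le.2 ?_
      rintro _ ⟨w, hw, rfl⟩
      exact ⟨monomial A x w, AlFil_antitone hw.1 (monomial_mem_AlIdeal w), Al.map_monomial hπ x w⟩
    obtain ⟨a', ha', rfl⟩ := hle hu
    refine ⟨a', ha', ?_⟩
    rw [map_sub, ← huv]
    change (Al.map A π hπ) a' + v - (Al.map A π hπ) a' ∈ _
    rwa [add_sub_cancel_left]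
  obtain ⟨b, hb⟩ := hM _ (AlFil_antitone (le_max_left M N) haM)
  rw [Al.ev_map] at hb
  have hinj : Function.Injective (quotMap π hπ V) := by
    rw [injective_iff_map_eq_one]
    intro g hg
    obtain ⟨g, rfl⟩ := QuotientGroup.mk_surjective g
    exact (QuotientGroup.eq_one_iff g).2
      ((QuotientGroup.eq_one_iff (N := V.toSubgroup) (π g)).1 hg)
  obtain ⟨c, hc⟩ : ∃ c : Al A F,
      MonoidAlgebra.mapDomainAlgHom A A (quotMap π hπ V) (Al.ev A W c) = b := by
    exact Al.ev_map_surjective hπ hsurj V b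
  have hd : Al.ev A W (a - a' - (p : A) ^ k • c) = 0 := by
    have hinj' : Function.Injective
      (MonoidAlgebra.mapDomainAlgHom A A (quotMap π hπ V)) := MonoidAlgebra.mapDomain_injective hinj
    apply hinj'
    rw [map_sub, map_sub, map_smul, map_smul, hc, hb, sub_self, map_zero]
  obtain ⟨r, hr, hrd⟩ : ∃ r ∈ relSub A π, Al.ev A U r = Al.ev A U (a - a' - (p : A) ^ k • c) := by
    have := mem_of_mapDomain_eq_zero (quotProj hUW) ((relSub A π).map (Al.ev A U).toLinearMap)
      (fun g h hh => ?_) ((Al.map_ev hUW _).trans hd)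
    · exact this
    · obtain ⟨g, rfl⟩ := QuotientGroup.mk_surjective g
      obtain ⟨h, rfl⟩ := QuotientGroup.mk_surjective h
      have hh' : h ∈ W.toSubgroup := (QuotientGroup.eq_one_iff h).1 hh
      obtain ⟨u, hu, hπu⟩ := hh'
      refine ⟨Al.of A g * (Al.of A (h * u⁻¹) - 1), ?_, ?_⟩
      · refine (relIdeal A π).mul_mem_left _ (sub_one_mem_relSub ?_)
        rw [MonoidHom.mem_ker, map_mul, map_inv, ← hπu, mul_inv_cancel]
      · have e : (QuotientGroup.mk (h * u⁻¹) : F ⧸ U.toSubgroup) = QuotientGroup.mk h := by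
          rw [QuotientGroup.eq]
          simpa using hu
        change Al.ev A U _ = _
        rw [map_mul, map_sub, map_one, Al.ev_of, Al.ev_of, e, mul_sub, mul_one, map_mul]
  obtain ⟨b', hb'⟩ := hU (a - a' - (p : A) ^ k • c - r) (by rw [map_sub, hrd, sub_self])
  refine ⟨c + b', ?_⟩
  have e : a - (p : A) ^ k • (c + b') =
      a' + (a - a' - (p : A) ^ k • c - r - (p : A) ^ k • b') + r := by
    rw [smul_add]
    abel
  rw [e]
  exact Submodule.add_mem_sup (Submodule.add_mem _ ha' hb') hr

theorem comap_wtFil {wt : J → ℕ} (hA : IsCoeffRing p A) (hx : TopGenerates x) (hG : IsProP p G)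
    (hπ : Continuous π) (hsurj : Function.Surjective π) (m : ℕ) :
    (wtFil A (fun j => π (x j)) wt m).comap (Al.map A π hπ).toLinearMap =
      wtFil A x wt m ⊔ relSub A π := by
  apply le_antisymm
  · intro a ha
    obtain ⟨u, hu, v, hv, huv⟩ := Submodule.mem_sup.1 (Submodule.mem_comap.1 ha)
    rw [← map_wtSpan hπ x] at hu
    obtain ⟨b, hb, rfl⟩ := hu
    have h : Al.map A π hπ (a - b) ∈ AlFil A G m := by
      rw [map_sub]
      change (Al.map A π hπ) b + v = (Al.map A π hπ) a at huv
      rwa [← huv, add_sub_cancel_left]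
    rw [← add_sub_cancel b a, wtFil, sup_assoc]
    exact Submodule.add_mem_sup hb (mem_AlFil_sup_relSub hA hx hG hπ hsurj h)
  · refine sup_le (Submodule.map_le_iff_le_comap.1 (map_wtFil_le hπ x wt m)) fun a ha => ?_
    rw [Submodule.mem_comap, LinearMap.mem_ker.1 (relSub_le_ker hπ ha)]
    exact Submodule.zero_mem _

end Kernel

/-! ### Powers with exponents in the coefficient ring -/

section Powers

variable {A : Type*} [CommRing A] {G : Type*} [Group G] [TopologicalSpace G]

/-- `h` is a limit of powers of `g` whose exponents tend `p`-adically to `a`. -/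
def IsLimPow (p : ℕ) (a : A) (g h : G) : Prop :=
  ∀ (k : ℕ) (U : OpenNormalSubgroup G), ∃ (n : ℕ) (b : A),
    a = n + (p : A) ^ k * b ∧ h⁻¹ * g ^ n ∈ U.toSubgroup

theorem IsPadicPow.isLimPow {p : ℕ} [Fact p.Prime] [Algebra ℤ_[p] A] [IsTopologicalGroup G]
    {g h : G} {z : ℤ_[p]} (hz : IsPadicPow g z h) : IsLimPow p (algebraMap ℤ_[p] A z) g h := by
  intro k U
  have h1 : Tendsto (fun l : ℕ => h⁻¹ * g ^ z.appr l) atTop (𝓝 (h⁻¹ * h)) :=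
    hz.const_mul h⁻¹
  rw [inv_mul_cancel] at h1
  have h2 := h1.eventually (U.isOpen'.mem_nhds U.one_mem')
  obtain ⟨l, hl, hlk⟩ := (h2.and (eventually_ge_atTop k)).exists
  obtain ⟨b, hb⟩ := Ideal.mem_span_singleton.1 (PadicInt.appr_spec l z)
  refine ⟨z.appr l, algebraMap ℤ_[p] A ((p : ℤ_[p]) ^ (l - k) * b), ?_, hl⟩
  have e : z = z.appr l + (p : ℤ_[p]) ^ k * ((p : ℤ_[p]) ^ (l - k) * b) := by
    rw [← mul_assoc, ← pow_add, Nat.add_sub_cancel' hlk, ← hb]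
    ring
  conv_lhs => rw [e]
  simp

/-- In a compact group, every element has powers with exponents in the coefficient ring. -/
theorem IsCoeffRing.exists_isLimPow {p : ℕ} (hA : IsCoeffRing p A) [IsTopologicalGroup G]
    [CompactSpace G] (a : A) (g : G) : ∃ h, IsLimPow p a g h := by
  choose n b hnb using fun k => hA.exists_nat a k
  obtain ⟨h, hh⟩ := exists_clusterPt_of_compactSpace (map (fun k => g ^ n k) atTop)
  refine ⟨h, fun k U => ?_⟩
  have hU : {y : G | h⁻¹ * y ∈ U.toSubgroup} ∈ 𝓝 h := by
    have hc : Continuous fun y : G => h⁻¹ * y := continuous_const.mul continuous_id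
    refine (U.isOpen'.preimage hc).mem_nhds ?_
    change h⁻¹ * h ∈ U.toSubgroup
    rw [inv_mul_cancel]
    exact U.one_mem'
  have hf : ∃ᶠ k in atTop, g ^ n k ∈ {y : G | h⁻¹ * y ∈ U.toSubgroup} :=
    (mapClusterPt_iff_frequently.1 hh) _ hU
  obtain ⟨l, hlk, hl⟩ := (frequently_atTop.1 hf) k
  refine ⟨n l, (p : A) ^ (l - k) * b l, ?_, hl⟩
  rw [← mul_assoc, ← pow_add, Nat.add_sub_cancel' hlk]
  exact hnb l

variable (A) in
/-- The span of the powers `(g - 1) ^ i` with `i ≥ 2`. -/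
def powSpan (g : G) : Submodule A (Al A G) :=
  Submodule.span A ((fun i : ℕ => (Al.of A g - 1) ^ i) '' {i | 2 ≤ i})

theorem mul_mem_powSpan {g : G} {v : Al A G} (hv : v ∈ powSpan A g) :
    v * (Al.of A g - 1) ∈ powSpan A g := by
  induction hv using Submodule.span_induction with
  | mem v hv =>
    obtain ⟨i, hi, rfl⟩ := hv
    exact Submodule.subset_span ⟨i + 1, Nat.le_succ_of_le hi, pow_succ _ _⟩
  | zero => rw [zero_mul]; exact Submodule.zero_mem _
  | add v w _ _ hv hw => rw [add_mul]; exact Submodule.add_mem _ hv hw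
  | smul a v _ hv => rw [smul_mul_assoc]; exact Submodule.smul_mem _ a hv

theorem of_pow_sub_mem_powSpan (g : G) (n : ℕ) :
    Al.of A (g ^ n) - 1 - (n : A) • (Al.of A g - 1) ∈ powSpan A g := by
  induction n with
  | zero =>
    rw [pow_zero, map_one, sub_self, Nat.cast_zero, zero_smul, sub_zero]
    exact Submodule.zero_mem _
  | succ n ih =>
    have h2 : (Al.of A g - 1) ^ 2 ∈ powSpan A g := Submodule.subset_span ⟨2, le_refl 2, rfl⟩
    have e : Al.of A (g ^ (n + 1)) - 1 - ((n + 1 : ℕ) : A) • (Al.of A g - 1) =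
        (Al.of A (g ^ n) - 1 - (n : A) • (Al.of A g - 1)) +
        (Al.of A (g ^ n) - 1 - (n : A) • (Al.of A g - 1)) * (Al.of A g - 1) +
        (n : A) • (Al.of A g - 1) ^ 2 := by
      have e0 : Al.of A (g ^ (n + 1)) - 1 = (Al.of A (g ^ n) - 1) +
          (Al.of A (g ^ n) - 1) * (Al.of A g - 1) + (Al.of A g - 1) := by
        rw [pow_succ, map_mul, sub_mul, mul_sub, one_mul, mul_one]
        abel
      rw [e0, Nat.cast_succ, add_smul, one_smul, sub_mul _ ((n : A) • _), smul_mul_assoc,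
        ← pow_two]
      abel
    rw [e]
    exact Submodule.add_mem _ (Submodule.add_mem _ ih (mul_mem_powSpan ih))
      (Submodule.smul_mem _ _ h2)

variable {p : ℕ} [Fact p.Prime] [IsTopologicalGroup G] [CompactSpace G] {J : Type*} [Finite J]
  {x : J → G}

/-- The binomial expansion of a power with exponent in the coefficient ring. -/
theorem IsLimPow.of_sub_mem (hA : IsCoeffRing p A) (hx : TopGenerates x) {a : A} {g h : G}
    (hh : IsLimPow p a g h) (N : ℕ) :
    Al.of A h - 1 - a • (Al.of A g - 1) ∈ powSpan A g ⊔ AlFil A G N := by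
  have hfin : Module.Finite A (Al A G ⧸ (powSpan A g ⊔ AlFil A G N)) :=
    finite_quotient_of_AlFil_le hA hx le_sup_right
  refine hA.mem_of_forall_pow (powSpan A g ⊔ AlFil A G N) fun k => ?_
  obtain ⟨U, hU⟩ := exists_open_le_AlFil hA hx N k
  obtain ⟨n, b, rfl, hn⟩ := hh k U
  obtain ⟨c, hc⟩ := hU (Al.of A h - Al.of A (g ^ n)) (by
    rw [map_sub, Al.ev_of, Al.ev_of, QuotientGroup.eq.2 hn, sub_self])
  refine ⟨c - b • (Al.of A g - 1), ?_⟩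
  have e : Al.of A h - 1 - ((n : A) + (p : A) ^ k * b) • (Al.of A g - 1) -
      (p : A) ^ k • (c - b • (Al.of A g - 1)) =
      (Al.of A (g ^ n) - 1 - (n : A) • (Al.of A g - 1)) +
      (Al.of A h - Al.of A (g ^ n) - (p : A) ^ k • c) := by
    rw [add_smul, mul_smul, smul_sub ((p : A) ^ k)]
    abel
  rw [e]
  exact Submodule.add_mem_sup (of_pow_sub_mem_powSpan g n) hc

end Powers

/-! ### Products, operators and group elements in the weight filtration -/

section Action

variable {A : Type*} [CommRing A] {G : Type*} [Group G] [TopologicalSpace G]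
  {J : Type*} {x : J → G} {wt : J → ℕ}

theorem wtFil_zero : wtFil A x wt 0 = ⊤ := by
  rw [wtFil, AlFil, AlIdeal_zero]
  exact sup_top_eq _

theorem wtFil_le_AlFil {q : ℕ} (hq : 1 ≤ q) (hwt : ∀ j, wt j ≤ q) (n : ℕ) :
    wtFil A x wt (q * n + 1) ≤ AlFil A G (n + 1) := by
  refine sup_le (Submodule.span_le.2 ?_) (AlFil_antitone ?_)
  · rintro _ ⟨w, hw, rfl⟩
    refine AlFil_antitone ?_ (monomial_mem_AlIdeal w)
    have h1 : q * n + 1 ≤ q * w.length := le_trans hw (wordWeight_le hwt w)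
    by_contra h2
    have := Nat.mul_le_mul_left q (show w.length ≤ n by omega)
    omega
  · have := Nat.le_mul_of_pos_left n hq
    omega

theorem powSpan_le_wtSpan (hwt : ∀ j, 1 ≤ wt j) (j : J) :
    powSpan A (x j) ≤ wtSpan A x wt (wt j + 1) := by
  refine Submodule.span_le.2 ?_
  rintro _ ⟨i, hi, rfl⟩
  refine Submodule.subset_span ⟨List.replicate i j, ?_, ?_⟩
  · have hi' : 2 ≤ i := hi
    rw [Set.mem_ofPred_eq, wordWeight, List.map_replicate, List.sum_replicate, smul_eq_mul]
    have := hwt j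
    nlinarith
  · rw [monomial, List.map_replicate, List.prod_replicate]

theorem monomial_mem_wtFil {m : ℕ} {w : List J} (h : m ≤ wordWeight wt w) :
    monomial A x w ∈ wtFil A x wt m := Submodule.mem_sup_left (monomial_mem_wtSpan h)

variable {p : ℕ} [IsTopologicalGroup G] [CompactSpace G] [Finite J]

theorem mul_mem_wtFil (hA : IsCoeffRing p A) (hx : TopGenerates x) (hwt : ∀ j, 1 ≤ wt j)
    {m n : ℕ} {u v : Al A G} (hu : u ∈ wtFil A x wt m) (hv : v ∈ wtFil A x wt n) :
    u * v ∈ wtFil A x wt (m + n) := by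
  rw [wtFil_eq_sup hA hx hwt (Nat.le_add_right m n)] at hu
  rw [wtFil_eq_sup hA hx hwt (Nat.le_add_left n m)] at hv
  obtain ⟨u, hus, u', hu', rfl⟩ := Submodule.mem_sup.1 hu
  obtain ⟨v, hvs, v', hv', rfl⟩ := Submodule.mem_sup.1 hv
  have h1 : u * v ∈ wtSpan A x wt (m + n) := by
    have h : wtSpan A x wt m * wtSpan A x wt n ≤ wtSpan A x wt (m + n) := by
      rw [wtSpan, wtSpan, Submodule.span_mul_span]
      refine Submodule.span_le.2 ?_
      rintro _ ⟨_, ⟨w, hw, rfl⟩, _, ⟨w', hw', rfl⟩, rfl⟩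
      change monomial A x w * monomial A x w' ∈ _
      rw [← monomial_append]
      exact monomial_mem_wtSpan (by rw [wordWeight_append]; exact add_le_add hw hw')
    exact h (Submodule.mul_mem_mul hus hvs)
  have e : (u + u') * (v + v') = u * v + (u * v' + u' * (v + v')) := by noncomm_ring
  rw [e]
  exact Submodule.add_mem_sup h1 (Ideal.add_mem _ (Ideal.mul_mem_left _ u hv')
    (AlIdeal_mul_mem_right _ hu' _))

/-- An algebra endomorphism that multiplies each `X_j` by `ζ ^ wt j` up to higher weight acts as
`ζ ^ m` on the piece of weight `m`. -/
theorem sub_smul_mem_wtFil (hA : IsCoeffRing p A) (hx : TopGenerates x) (hwt : ∀ j, 1 ≤ wt j)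
    (D : Al A G →ₐ[A] Al A G) (hD : ∀ n, ∀ a ∈ AlIdeal A G n, D a ∈ AlIdeal A G n) {ζ : A}
    (hζ : ∀ j, D (Al.of A (x j) - 1) - ζ ^ wt j • (Al.of A (x j) - 1) ∈ wtFil A x wt (wt j + 1))
    {m : ℕ} {v : Al A G} (hv : v ∈ wtFil A x wt m) :
    D v - ζ ^ m • v ∈ wtFil A x wt (m + 1) := by
  have key : ∀ w, D (monomial A x w) - ζ ^ wordWeight wt w • monomial A x w ∈
      wtFil A x wt (wordWeight wt w + 1) := by
    intro w
    induction w with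
    | nil => simp [monomial, wordWeight]
    | cons j w ih =>
      have e1 : monomial A x (j :: w) = (Al.of A (x j) - 1) * monomial A x w := by
        simp [monomial]
      have e2 : wordWeight wt (j :: w) = wt j + wordWeight wt w := by simp [wordWeight]
      have hDw : D (monomial A x w) ∈ wtFil A x wt (wordWeight wt w) := by
        have := Submodule.add_mem _ (wtFil_antitone (Nat.le_succ _) ih)
          (Submodule.smul_mem _ (ζ ^ wordWeight wt w) (monomial_mem_wtFil (A := A) (x := x) le_rfl))
        rwa [sub_add_cancel] at this
      have hj : Al.of A (x j) - 1 ∈ wtFil A x wt (wt j) := by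
        rw [← monomial_singleton]
        exact monomial_mem_wtFil (by simp [wordWeight])
      have e3 : D (monomial A x (j :: w)) -
          ζ ^ wordWeight wt (j :: w) • monomial A x (j :: w) =
          (D (Al.of A (x j) - 1) - ζ ^ wt j • (Al.of A (x j) - 1)) * D (monomial A x w) +
          ζ ^ wt j • ((Al.of A (x j) - 1) *
            (D (monomial A x w) - ζ ^ wordWeight wt w • monomial A x w)) := by
        rw [e1, e2, map_mul, pow_add, mul_smul, sub_mul (D _), smul_mul_assoc, mul_sub,
          mul_smul_comm, smul_sub]
        abel
      have h4 := mul_mem_wtFil hA hx hwt hj ih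
      rw [← add_assoc] at h4
      rw [e3, e2]
      refine Submodule.add_mem _ ?_ (Submodule.smul_mem _ _ h4)
      rw [add_right_comm]
      exact mul_mem_wtFil hA hx hwt (hζ j) hDw
  rw [wtFil_eq_sup hA hx hwt (Nat.le_succ m)] at hv
  obtain ⟨u, hu, u', hu', rfl⟩ := Submodule.mem_sup.1 hv
  clear hv
  rw [map_add, smul_add, add_sub_add_comm]
  refine Submodule.add_mem _ ?_ (Submodule.mem_sup_right
    (Submodule.sub_mem _ (hD _ _ hu') (Submodule.smul_mem _ _ hu')))
  induction hu using Submodule.span_induction with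
  | mem u hu =>
    obtain ⟨w, hw, rfl⟩ := hu
    rcases (show m ≤ wordWeight wt w from hw).eq_or_lt with h | h
    · rw [h]
      exact key w
    · have h1 := monomial_mem_wtFil (A := A) (x := x) (show m + 1 ≤ wordWeight wt w from h)
      have h2 := Submodule.add_mem _ (wtFil_antitone (Nat.le_succ_of_le h) (key w))
        (Submodule.smul_mem _ (ζ ^ wordWeight wt w) h1)
      rw [sub_add_cancel] at h2
      exact Submodule.sub_mem _ h2 (Submodule.smul_mem _ _ h1)
  | zero => rw [map_zero, smul_zero, sub_zero]; exact Submodule.zero_mem _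
  | add u u' _ _ h h' =>
    rw [map_add, smul_add, add_sub_add_comm]
    exact Submodule.add_mem _ h h'
  | smul a u _ h =>
    rw [map_smul, smul_comm, ← smul_sub]
    exact Submodule.smul_mem _ a h

variable (A G) in
/-- The elements `g - 1` of the completed group algebra. -/
def grpSet : Set (Al A G) := Set.range fun g : G => Al.of A g - 1

/-- The elements of a group filtration have a submodule as their image in the graded piece:
products of group elements correspond to sums and powers with exponents in the coefficient ring to
multiples. -/
theorem exists_mem_grpSet [Fact p.Prime] (hA : IsCoeffRing p A) (hx : TopGenerates x)
    (hwt : ∀ j, 1 ≤ wt j) (m j : ℕ) :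
    ∀ v ∈ Submodule.span A (grpSet A G ∩ (AlFil A G j ∩ wtFil A x wt m)),
      ∃ s ∈ grpSet A G, s ∈ AlFil A G j ∧ s ∈ wtFil A x wt m ∧
        v - s ∈ AlFil A G (j + 1) ∧ v - s ∈ wtFil A x wt (m + 1) := by
  have hX1 : ∀ g : G, Al.of A g - 1 ∈ AlFil A G 1 := by
    intro g
    change _ ∈ AlIdeal A G 1
    rw [AlIdeal_one]
    exact of_sub_one_mem_ker_aug g
  have hmul : ∀ {u v : Al A G}, u ∈ AlFil A G j → u ∈ wtFil A x wt m → v ∈ AlFil A G 1 →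
      u * v ∈ AlFil A G (j + 1) ∧ u * v ∈ wtFil A x wt (m + 1) := fun hu hu' hv =>
    ⟨AlIdeal_mul_mem hu hv, mul_mem_wtFil hA hx hwt hu' (Submodule.mem_sup_right hv)⟩
  intro v hv
  induction hv using Submodule.span_induction with
  | mem v hv => exact ⟨v, hv.1, hv.2.1, hv.2.2, by rw [sub_self]; exact Submodule.zero_mem _,
      by rw [sub_self]; exact Submodule.zero_mem _⟩
  | zero =>
    refine ⟨0, ⟨1, by simp⟩, Submodule.zero_mem _, Submodule.zero_mem _, ?_, ?_⟩ <;>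
    · rw [sub_self]; exact Submodule.zero_mem _
  | add v w _ _ hv hw =>
    obtain ⟨_, ⟨g, rfl⟩, h1, h2, h3, h4⟩ := hv
    obtain ⟨_, ⟨h, rfl⟩, k1, k2, k3, k4⟩ := hw
    obtain ⟨l1, l2⟩ := hmul h1 h2 (hX1 h)
    have e : Al.of A (g * h) - 1 = (Al.of A g - 1) + (Al.of A h - 1) +
        (Al.of A g - 1) * (Al.of A h - 1) := by
      rw [map_mul, sub_mul, mul_sub, one_mul, mul_one]
      abel
    have e' : v + w - (Al.of A (g * h) - 1) = (v - (Al.of A g - 1)) + (w - (Al.of A h - 1)) -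
        (Al.of A g - 1) * (Al.of A h - 1) := by
      rw [e]
      abel
    refine ⟨Al.of A (g * h) - 1, ⟨g * h, rfl⟩, ?_, ?_, ?_, ?_⟩
    · rw [e]
      exact Submodule.add_mem _ (Submodule.add_mem _ h1 k1) (AlFil_antitone (Nat.le_succ j) l1)
    · rw [e]
      exact Submodule.add_mem _ (Submodule.add_mem _ h2 k2) (wtFil_antitone (Nat.le_succ m) l2)
    · rw [e']
      exact Submodule.sub_mem _ (Submodule.add_mem _ h3 k3) l1
    · rw [e']
      exact Submodule.sub_mem _ (Submodule.add_mem _ h4 k4) l2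
  | smul a v _ hv =>
    obtain ⟨_, ⟨g, rfl⟩, h1, h2, h3, h4⟩ := hv
    obtain ⟨h, hh⟩ := hA.exists_isLimPow a g
    have h5 := hh.of_sub_mem hA hx (max (j + 1) (m + 1))
    have hpow : powSpan A g ⊔ AlFil A G (max (j + 1) (m + 1)) ≤
        AlFil A G (j + 1) ⊓ wtFil A x wt (m + 1) := by
      refine sup_le (Submodule.span_le.2 ?_) (le_inf (AlFil_antitone (le_max_left _ _))
        ((AlFil_antitone (le_max_right _ _)).trans le_sup_right))
      rintro _ ⟨i, hi, rfl⟩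
      have hi' : 2 ≤ i := hi
      obtain ⟨i, rfl⟩ := Nat.exists_eq_add_of_le hi'
      have e : (Al.of A g - 1) ^ (2 + i) =
          (Al.of A g - 1) * ((Al.of A g - 1) ^ i * (Al.of A g - 1)) := by
        rw [← pow_succ, ← pow_succ']
        congr 1
        omega
      change (Al.of A g - 1) ^ (2 + i) ∈ _
      rw [e]
      exact hmul h1 h2 (Ideal.mul_mem_left _ _ (hX1 g))
    obtain ⟨h6, h7⟩ := hpow h5
    have e1 : Al.of A h - 1 = a • (Al.of A g - 1) +
        (Al.of A h - 1 - a • (Al.of A g - 1)) := by abel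
    have e2 : a • v - (Al.of A h - 1) = a • (v - (Al.of A g - 1)) -
        (Al.of A h - 1 - a • (Al.of A g - 1)) := by
      rw [smul_sub]
      abel
    refine ⟨Al.of A h - 1, ⟨h, rfl⟩, ?_, ?_, ?_, ?_⟩
    · rw [e1]
      exact Submodule.add_mem _ (Submodule.smul_mem _ _ h1) (AlFil_antitone (Nat.le_succ j) h6)
    · rw [e1]
      exact Submodule.add_mem _ (Submodule.smul_mem _ _ h2) (wtFil_antitone (Nat.le_succ m) h7)
    · rw [e2]
      exact Submodule.sub_mem _ (Submodule.smul_mem _ _ h3) h6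
    · rw [e2]
      exact Submodule.sub_mem _ (Submodule.smul_mem _ _ h4) h7

end Action

/-! ### Characters of a cyclic group of order `q` -/

section Characters

variable {p q : ℕ} [Fact p.Prime]

theorem IsCoeffRing.isUnit_natCast {A : Type*} [CommRing A] (hA : IsCoeffRing p A)
    (hqp : q ∣ p - 1) : IsUnit (q : A) := by
  have := hA.isLocalRing
  have h1 : IsUnit (1 - (p : A)) := IsLocalRing.isUnit_one_sub_self_of_mem_nonunits _ hA.not_isUnit
  have h2 : ((p - 1 : ℕ) : A) = -(1 - (p : A)) := by
    rw [Nat.cast_sub (Fact.out : p.Prime).one_le]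
    ring
  refine isUnit_of_dvd_unit (Nat.cast_dvd_cast hqp) ?_
  rw [h2]
  exact h1.neg

/-- A non-trivial `q`-th root of unity of `ℤ_p`, with `q` prime to `p`, is not congruent to `1`. -/
theorem isUnit_sub_one_of_pow_eq_one (hqp : q ∣ p - 1) {t : ℤ_[p]} (ht : t ^ q = 1) (h1 : t ≠ 1) :
    IsUnit (t - 1) := by
  have h2 : (∑ i ∈ Finset.range q, t ^ i) = 0 := by
    have h := geom_sum_mul t q
    rw [ht, sub_self] at h
    exact (mul_eq_zero.1 h).resolve_right (sub_ne_zero.2 h1)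
  have h3 : t - 1 ∣ (q : ℤ_[p]) := by
    have h4 : t - 1 ∣ ∑ i ∈ Finset.range q, (t ^ i - 1) :=
      Finset.dvd_sum fun i _ => sub_one_dvd_pow_sub_one t i
    rw [Finset.sum_sub_distrib, h2, Finset.sum_const, Finset.card_range, nsmul_one, zero_sub,
      dvd_neg] at h4
    exact h4
  exact isUnit_of_dvd_unit h3 (isCoeffRing_padicInt.isUnit_natCast hqp)

variable {Δ : Type*} [Group Δ] {δ₀ : Δ} {χ₀ : Δ →* ℤ_[p]ˣ}

theorem char_ext (hgen : ∀ δ : Δ, ∃ i : ℕ, δ = δ₀ ^ i) {χ χ' : Δ →* ℤ_[p]ˣ}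
    (h : χ δ₀ = χ' δ₀) : χ = χ' := by
  ext δ
  obtain ⟨i, rfl⟩ := hgen δ
  rw [map_pow, map_pow, h]

theorem orderOf_char (hq : q.Prime) (hgen : ∀ δ : Δ, ∃ i : ℕ, δ = δ₀ ^ i) (hδ : δ₀ ^ q = 1)
    (hχ₀ : χ₀ ≠ 1) : orderOf (χ₀ δ₀) = q := by
  have := Fact.mk hq
  refine orderOf_eq_prime (by rw [← map_pow, hδ, map_one]) fun h => hχ₀ (char_ext hgen ?_)
  rw [h, MonoidHom.one_apply]

theorem isUnit_char_pow_sub (hq : q.Prime) (hqp : q ∣ p - 1)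
    (hgen : ∀ δ : Δ, ∃ i : ℕ, δ = δ₀ ^ i) (hδ : δ₀ ^ q = 1) (hχ₀ : χ₀ ≠ 1) (a b : ℕ) :
    a ≡ b [MOD q] ∨ IsUnit ((χ₀ δ₀ : ℤ_[p]) ^ a - (χ₀ δ₀ : ℤ_[p]) ^ b) := by
  by_cases h : a ≡ b [MOD q]
  · exact Or.inl h
  right
  let z := χ₀ δ₀
  have hz : z ^ q = 1 := by rw [← map_pow, hδ, map_one]
  let t : ℤ_[p]ˣ := z ^ a * (z ^ b)⁻¹
  have ht : t ^ q = 1 := by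
    rw [mul_pow, inv_pow, pow_right_comm, pow_right_comm z b, hz, one_pow, one_pow, inv_one,
      mul_one]
  have ht1 : t ≠ 1 := by
    intro h1
    have h2 : z ^ a = z ^ b := mul_inv_eq_one.1 h1
    rw [pow_eq_pow_iff_modEq, orderOf_char hq hgen hδ hχ₀] at h2
    exact h h2
  have h3 := isUnit_sub_one_of_pow_eq_one hqp (t := (t : ℤ_[p]))
    (by rw [← Units.val_pow_eq_pow_val, ht, Units.val_one]) (fun h => ht1 (Units.ext h))
  have e : (z : ℤ_[p]) ^ a - (z : ℤ_[p]) ^ b = (t - 1) * ((z ^ b : ℤ_[p]ˣ) : ℤ_[p]) := by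
    have : t * z ^ b = z ^ a := inv_mul_cancel_right _ _
    rw [sub_mul, ← Units.val_mul, this, one_mul, Units.val_pow_eq_pow_val,
      Units.val_pow_eq_pow_val]
  change IsUnit ((z : ℤ_[p]) ^ a - (z : ℤ_[p]) ^ b)
  rw [e]
  exact h3.mul (Units.isUnit _)

/-- The infimum defining `psi` is attained, in `{1, …, q}`. -/
theorem psi_spec (hq : q.Prime) (hgen : ∀ δ : Δ, ∃ i : ℕ, δ = δ₀ ^ i) (hδ : δ₀ ^ q = 1)
    (hχ₀ : χ₀ ≠ 1) (χ : Δ →* ℤ_[p]ˣ) :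
    1 ≤ psi χ₀ χ ∧ psi χ₀ χ ≤ q ∧ χ₀ ^ psi χ₀ χ = χ := by
  have hz : (χ₀ δ₀) ^ q = 1 := by rw [← map_pow, hδ, map_one]
  obtain ⟨i, hi1, hiq, hi⟩ : ∃ i, 1 ≤ i ∧ i ≤ q ∧ χ₀ ^ i = χ := by
    have hpr : IsPrimitiveRoot ((χ₀ δ₀ : ℤ_[p]ˣ) : ℤ_[p]) q := by
      rw [IsPrimitiveRoot.coe_units_iff, ← orderOf_char hq hgen hδ hχ₀]
      exact IsPrimitiveRoot.orderOf _
    have : NeZero q := ⟨hq.ne_zero⟩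
    obtain ⟨i, hi, h⟩ := hpr.eq_pow_of_pow_eq_one (ξ := ((χ δ₀ : ℤ_[p]ˣ) : ℤ_[p]))
      (by rw [← Units.val_pow_eq_pow_val, ← map_pow, hδ, map_one, Units.val_one])
    have h' : (χ₀ ^ i) δ₀ = χ δ₀ := by
      rw [MonoidHom.pow_apply]
      exact Units.ext (by rw [Units.val_pow_eq_pow_val, h])
    rcases Nat.eq_zero_or_pos i with h0 | h0
    · refine ⟨q, hq.one_le, le_rfl, char_ext hgen ?_⟩
      rw [← h', h0, MonoidHom.pow_apply, hz, MonoidHom.pow_apply, pow_zero]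
    · exact ⟨i, h0, hi.le, char_ext hgen h'⟩
  have hmem : psi χ₀ χ ∈ {i : ℕ | 1 ≤ i ∧ χ₀ ^ i = χ} := Nat.sInf_mem ⟨i, hi1, hi⟩
  exact ⟨hmem.1, (Nat.sInf_le (show i ∈ {i : ℕ | 1 ≤ i ∧ χ₀ ^ i = χ} from ⟨hi1, hi⟩)).trans hiq,
    hmem.2⟩

end Characters

/-! ### The action of automorphisms on the completed group algebra -/

section Functoriality

variable {A : Type*} [CommRing A] {G : Type*} [Group G] [TopologicalSpace G]

theorem Al.map_mul_apply {δ ε : MulAut G} (hδ : Continuous ((δ : MulAut G) : G →* G))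
    (hε : Continuous ((ε : MulAut G) : G →* G))
    (hδε : Continuous (((δ * ε : MulAut G)) : G →* G)) (a : Al A G) :
    Al.map A ((δ * ε : MulAut G) : G →* G) hδε a =
      Al.map A (δ : G →* G) hδ (Al.map A (ε : G →* G) hε a) := by
  refine Al.ext_ev fun U => ?_
  have e : quotMap ((δ * ε : MulAut G) : G →* G) hδε U =
      (quotMap (δ : G →* G) hδ U).comp (quotMap (ε : G →* G) hε (comapOpen (δ : G →* G) hδ U)) := by
    ext g
    rfl
  have h := (congrArg (MonoidAlgebra.mapDomainAlgHom A A) e).trans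
    (MonoidAlgebra.mapDomainAlgHom_comp (R := A) (A := A) _ _)
  exact AlgHom.congr_fun h (Al.ev A (comapOpen (ε : G →* G) hε (comapOpen (δ : G →* G) hδ U)) a)

theorem Al.map_one_apply (h1 : Continuous ((1 : MulAut G) : G →* G)) (a : Al A G) :
    Al.map A ((1 : MulAut G) : G →* G) h1 a = a := by
  refine Al.ext_ev fun U => ?_
  have h : (comapOpen ((1 : MulAut G) : G →* G) h1 U).toSubgroup ≤ U.toSubgroup := fun _ hx => hx
  rw [Al.ev_map, ← Al.map_ev h]
  rfl

variable {Δ : Subgroup (MulAut G)} (hΔ : ∀ δ ∈ Δ, Continuous δ)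

variable (A) in
/-- The action of an element of `Δ` on the completed group algebra. -/
def Al.act (δ : Δ) : Al A G →ₐ[A] Al A G := Al.map A ((δ : MulAut G) : G →* G) (hΔ δ δ.2)

theorem Al.act_of (δ : Δ) (g : G) : Al.act A hΔ δ (Al.of A g) = Al.of A ((δ : MulAut G) g) :=
  Al.map_of _ g

theorem Al.act_pow_apply (δ : Δ) (i : ℕ) (a : Al A G) :
    ((Al.act A hΔ δ).toLinearMap ^ i) a = Al.act A hΔ (δ ^ i) a := by
  induction i with
  | zero => exact (Al.map_one_apply _ a).symm
  | succ i ih =>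
    rw [pow_succ', Module.End.mul_apply, ih]
    have e : ((δ ^ (i + 1) : Δ) : MulAut G) = (δ : MulAut G) * ((δ ^ i : Δ) : MulAut G) := by
      rw [pow_succ', Subgroup.coe_mul]
    simp only [Al.act, e]
    exact (Al.map_mul_apply _ _ _ a).symm

variable {p : ℕ} [Fact p.Prime] [Algebra ℤ_[p] A]

theorem eig_eq_eigenspace {δ₀ : Δ} (hgen : ∀ δ : Δ, ∃ i : ℕ, δ = δ₀ ^ i)
    (χ : Δ →* ℤ_[p]ˣ) (n : ℕ) :
    eig A Δ hΔ χ n = Module.End.eigenspace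
      (AlQuotMap A ((δ₀ : MulAut G) : G →* G) (hΔ δ₀ δ₀.2) n)
      (algebraMap ℤ_[p] A (χ δ₀ : ℤ_[p])) := by
  refine le_antisymm (iInf_le _ δ₀) (le_iInf fun δ => ?_)
  obtain ⟨i, rfl⟩ := hgen δ
  intro v hv
  rw [Module.End.mem_eigenspace_iff] at hv ⊢
  have key : ∀ v, AlQuotMap A (((δ₀ ^ i : Δ) : MulAut G) : G →* G) (hΔ _ (δ₀ ^ i).2) n v =
      (AlQuotMap A ((δ₀ : MulAut G) : G →* G) (hΔ δ₀ δ₀.2) n ^ i) v := by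
    intro v
    obtain ⟨a, rfl⟩ := (AlFil A G n).mkQ_surjective v
    have h : ∀ i : ℕ, (AlQuotMap A ((δ₀ : MulAut G) : G →* G) (hΔ δ₀ δ₀.2) n ^ i)
        ((AlFil A G n).mkQ a) = (AlFil A G n).mkQ
          (((Al.act A hΔ δ₀).toLinearMap ^ i) a) := by
      intro i
      induction i with
      | zero => rfl
      | succ i ih => rw [pow_succ', Module.End.mul_apply, ih, pow_succ', Module.End.mul_apply]; rfl
    rw [h, Al.act_pow_apply]
    rfl
  rw [key, map_pow, Units.val_pow_eq_pow_val, map_pow]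
  clear key
  generalize AlQuotMap A ((δ₀ : MulAut G) : G →* G) (hΔ δ₀ δ₀.2) n = T at hv
  generalize algebraMap ℤ_[p] A (χ δ₀ : ℤ_[p]) = c at hv
  induction i with
  | zero => rw [pow_zero, pow_zero, one_smul, Module.End.one_apply]
  | succ i ih =>
    rw [pow_succ T, Module.End.mul_apply, hv, map_smul, ih, smul_smul, pow_succ']

end Functoriality

/-! ### The filtration of the algebra of a presentation -/

section Comparison

variable {A : Type*} [CommRing A] {p : ℕ} [Fact p.Prime]
  {F : Type*} [Group F] [TopologicalSpace F] [IsTopologicalGroup F] [CompactSpace F]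
  {G : Type*} [Group G] {J : Type*} [Finite J] {x : J → F} {wt : J → ℕ} {π : F →* G}

theorem chiFil_eq_map (hA : IsCoeffRing p A) (hF : IsProP p F) (hx : TopGenerates x)
    (hwt : ∀ j, 1 ≤ wt j) (m : ℕ) :
    chiFil p A x wt π m = (wtFil A x wt m).map (toEQuot A π) := by
  rw [chiFil, serFil_eq_wtFil hA hF hx hwt]

variable [TopologicalSpace G] [IsTopologicalGroup G] [CompactSpace G] [T2Space G]

theorem comap_chiFil (hA : IsCoeffRing p A) (hF : IsProP p F) (hG : IsProP p G)
    (hx : TopGenerates x) (hwt : ∀ j, 1 ≤ wt j) (hπ : Continuous π)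
    (hsurj : Function.Surjective π) (m : ℕ) :
    (chiFil p A x wt π m).comap (toEQuot A π) =
      (wtFil A (fun j => π (x j)) wt m).comap (Al.map A π hπ).toLinearMap := by
  have hker : LinearMap.ker (toEQuot A π) = relSub A π := by
    ext a
    exact Submodule.Quotient.mk_eq_zero (relIdeal A π)
  rw [chiFil_eq_map hA hF hx hwt, Submodule.comap_map_eq, hker,
    comap_wtFil hA hx hG hπ hsurj]

theorem relRank_map_toEQuot (hA : IsCoeffRing p A) (hF : IsProP p F) (hG : IsProP p G)
    (hx : TopGenerates x) (hwt : ∀ j, 1 ≤ wt j) (hπ : Continuous π)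
    (hsurj : Function.Surjective π) (W : Submodule A (Al A F)) (m : ℕ) :
    relRank (W.map (toEQuot A π)) (chiFil p A x wt π m) =
      relRank (W.map (Al.map A π hπ).toLinearMap) (wtFil A (fun j => π (x j)) wt m) := by
  rw [← relRank_eq_of_map (toEQuot A π) (comap_chiFil hA hF hG hx hwt hπ hsurj m) rfl]
  exact relRank_eq_of_map _ rfl rfl

/-- The graded pieces of `E(A, G)` are those of the weight filtration of `Al(A, G)`. -/
theorem cChi_eq_relRank (hA : IsCoeffRing p A) (hF : IsProP p F) (hG : IsProP p G)
    (hx : TopGenerates x) (hwt : ∀ j, 1 ≤ wt j) (hπ : Continuous π)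
    (hsurj : Function.Surjective π) (m : ℕ) :
    cChi p A x wt π m = relRank (wtFil A (fun j => π (x j)) wt m)
      (wtFil A (fun j => π (x j)) wt (m + 1)) := by
  rw [← relRank_congr (map_wtFil_sup hA hx hwt hπ hsurj m),
    ← relRank_map_toEQuot hA hF hG hx hwt hπ hsurj, ← chiFil_eq_map hA hF hx hwt]
  rfl

theorem aChi_eq_relRank (hA : IsCoeffRing p A) (hF : IsProP p F) (hG : IsProP p G)
    (hx : TopGenerates x) (hwt : ∀ j, 1 ≤ wt j) (hπ : Continuous π)
    (hsurj : Function.Surjective π) (m : ℕ) :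
    aChi p A x wt π m = relRank
      (Submodule.span A (grpSet A G ∩ (wtFil A (fun j => π (x j)) wt m : Set (Al A G))))
      (wtFil A (fun j => π (x j)) wt (m + 1)) := by
  have hgr : ∀ f : F, toEQuot A π (Al.of A f - 1) ∈ chiFil p A x wt π m ↔
      Al.of A (π f) - 1 ∈ wtFil A (fun j => π (x j)) wt m := by
    intro f
    rw [← Submodule.mem_comap, comap_chiFil hA hF hG hx hwt hπ hsurj, Submodule.mem_comap]
    change Al.map A π hπ (Al.of A f - 1) ∈ _ ↔ _
    rw [map_sub, Al.map_of, map_one]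
  have hmem : ∀ f : F, π f ∈ chiGrp p A x wt π m ↔
      Al.of A (π f) - 1 ∈ wtFil A (fun j => π (x j)) wt m := by
    intro f
    constructor
    · rintro ⟨f', hf', h⟩
      rw [hgr, hf'] at h
      exact h
    · intro h
      exact ⟨f, rfl, (hgr f).2 h⟩
  let T : Set (Al A F) := {v | ∃ f : F,
    Al.of A (π f) - 1 ∈ wtFil A (fun j => π (x j)) wt m ∧ v = Al.of A f - 1}
  have h1 : {v | ∃ f : F, π f ∈ chiGrp p A x wt π m ∧ v = toEQuot A π (Al.of A f - 1)} =
      toEQuot A π '' T := by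
    ext v
    constructor
    · rintro ⟨f, hf, rfl⟩
      exact ⟨_, ⟨f, (hmem f).1 hf, rfl⟩, rfl⟩
    · rintro ⟨_, ⟨f, hf, rfl⟩, rfl⟩
      exact ⟨f, (hmem f).2 hf, rfl⟩
  have h2 : grpSet A G ∩ (wtFil A (fun j => π (x j)) wt m : Set (Al A G)) =
      (Al.map A π hπ).toLinearMap '' T := by
    ext v
    constructor
    · rintro ⟨⟨g, rfl⟩, hv⟩
      obtain ⟨f, rfl⟩ := hsurj g
      refine ⟨Al.of A f - 1, ⟨f, hv, rfl⟩, ?_⟩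
      change Al.map A π hπ (Al.of A f - 1) = _
      rw [map_sub, Al.map_of, map_one]
    · rintro ⟨_, ⟨f, hf, rfl⟩, rfl⟩
      have e : (Al.map A π hπ).toLinearMap (Al.of A f - 1) = Al.of A (π f) - 1 := by
        change Al.map A π hπ (Al.of A f - 1) = _
        rw [map_sub, Al.map_of, map_one]
      rw [e]
      exact ⟨⟨π f, rfl⟩, hf⟩
  rw [h2, ← Submodule.map_span, ← relRank_map_toEQuot hA hF hG hx hwt hπ hsurj,
    Submodule.map_span, ← h1, relRank, Submodule.map_span]
  rfl

end Comparison

/-! ### The inequalities -/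

section Assembly

variable {A : Type*} [CommRing A] {p q : ℕ} [Fact p.Prime] [Algebra ℤ_[p] A]
  {G : Type*} [Group G] [TopologicalSpace G] [IsTopologicalGroup G] [CompactSpace G]
  {Δ : Subgroup (MulAut G)} {J : Type*} [Finite J]

/-- The filtrations of `Al(A, G)` by the powers of the augmentation ideal and by the weight, with
the action of a generator of `Δ`. -/
def alBifiltration (hA : IsCoeffRing p A) (hq : q.Prime) (hqp : q ∣ p - 1)
    (hΔ : ∀ δ ∈ Δ, Continuous δ) {δ₀ : Δ} (hgen : ∀ δ : Δ, ∃ i : ℕ, δ = δ₀ ^ i) (hδ : δ₀ ^ q = 1)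
    {χ₀ : Δ →* ℤ_[p]ˣ} (hχ₀ : χ₀ ≠ 1) {y : J → G} (hy : TopGenerates y)
    {ch : J → (Δ →* ℤ_[p]ˣ)}
    (hdiag : ∀ j, IsPadicPow (y j) (ch j δ₀ : ℤ_[p]) ((δ₀ : MulAut G) (y j)))
    (S : Set (Al A G))
    (hS : ∀ s ∈ S, Al.act A hΔ δ₀ s ∈ S)
    (hmem : ∀ m j, ∀ v ∈ Submodule.span A (S ∩ (AlFil A G j ∩
        wtFil A y (fun j => psi χ₀ (ch j)) m)),
      ∃ s ∈ S, s ∈ AlFil A G j ∧ s ∈ wtFil A y (fun j => psi χ₀ (ch j)) m ∧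
        v - s ∈ AlFil A G (j + 1) ∧ v - s ∈ wtFil A y (fun j => psi χ₀ (ch j)) (m + 1)) :
    EigenBifiltration A (Al A G) q :=
  have hwt : ∀ j, 1 ≤ psi χ₀ (ch j) := fun j => (psi_spec hq hgen hδ hχ₀ (ch j)).1
  have hsub : ∀ m, ∀ v ∈ wtFil A y (fun j => psi χ₀ (ch j)) m,
      Al.act A hΔ δ₀ v -
        algebraMap ℤ_[p] A (χ₀ δ₀ : ℤ_[p]) ^ m • v ∈
          wtFil A y (fun j => psi χ₀ (ch j)) (m + 1) := fun m v hv => by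
    refine sub_smul_mem_wtFil hA hy hwt (Al.act A hΔ δ₀) (fun n a ha => AlIdeal_map _ _ n a ha)
      (fun j => ?_) hv
    have h1 := (hdiag j).isLimPow (A := A).of_sub_mem hA hy (psi χ₀ (ch j) + 1)
    have h2 : (ch j δ₀ : ℤ_[p]) = (χ₀ δ₀ : ℤ_[p]) ^ psi χ₀ (ch j) := by
      conv_lhs => rw [← (psi_spec hq hgen hδ hχ₀ (ch j)).2.2]
      rw [MonoidHom.pow_apply, Units.val_pow_eq_pow_val]
    rw [h2, map_pow] at h1
    have e : Al.act A hΔ δ₀ (Al.of A (y j) - 1) = Al.of A ((δ₀ : MulAut G) (y j)) - 1 := by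
      rw [map_sub, Al.act_of, map_one]
    rw [e]
    have h3 : powSpan A (y j) ⊔ AlFil A G (psi χ₀ (ch j) + 1) ≤
        wtFil A y (fun j => psi χ₀ (ch j)) (psi χ₀ (ch j) + 1) :=
      sup_le_sup_right (powSpan_le_wtSpan (wt := fun j => psi χ₀ (ch j)) hwt j) _
    exact h3 h1
  { P := AlFil A G
    Q := wtFil A y fun j => psi χ₀ (ch j)
    D := (Al.act A hΔ δ₀).toLinearMap
    ζ := algebraMap ℤ_[p] A (χ₀ δ₀ : ℤ_[p])
    S := S
    P_anti := AlFil_antitone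
    Q_anti := wtFil_antitone
    P_zero := AlFil_zero
    P_le_Q := fun n => le_sup_right
    Q_le_P := wtFil_le_AlFil hq.one_le fun j => (psi_spec hq hgen hδ hχ₀ (ch j)).2.1
    map_P := fun n a ha => AlIdeal_map _ _ n a ha
    map_Q := fun n v hv => by
      have h := Submodule.add_mem _ (wtFil_antitone (Nat.le_succ n) (hsub n v hv))
        (Submodule.smul_mem _ (algebraMap ℤ_[p] A (χ₀ δ₀ : ℤ_[p]) ^ n) hv)
      rwa [sub_add_cancel] at h
    D_sub := hsub
    D_pow := by
      ext1 a
      rw [Al.act_pow_apply, hδ]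
      exact Al.map_one_apply _ a
    ζ_pow := by
      rw [← map_pow, ← Units.val_pow_eq_pow_val, ← map_pow, hδ, map_one, Units.val_one, map_one]
    isUnit_q := hA.isUnit_natCast hqp
    ζ_sub := fun a b => (isUnit_char_pow_sub hq hqp hgen hδ hχ₀ a b).imp_right fun h => by
      have := h.map (algebraMap ℤ_[p] A)
      rwa [map_sub, map_pow, map_pow] at this
    map_S := hS
    exists_mem := hmem
    finite := finite_quotient_AlFil hA hy }

/-- Reindexing by `m = q k + r` a sum over the `m ∈ [n, q n]` congruent to `r`. -/
theorem sum_modEq_le_sum_Icc (hq : 1 ≤ q) (f : ℕ → ℕ) (n r : ℕ) :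
    ∑ m ∈ (Finset.Icc n (q * n)).filter (fun m => r ≡ m [MOD q]), f m ≤
      ∑ k ∈ Finset.Icc ⌈((n : ℚ) - r) / q⌉ ⌊(n : ℚ) - r / q⌋, f (q * k + r).toNat := by
  classical
  let κ : ℕ → ℤ := fun m => ((m : ℤ) - r) / q
  have hκ : ∀ m ∈ (Finset.Icc n (q * n)).filter (fun m => r ≡ m [MOD q]),
      (q : ℤ) * κ m + r = m := by
    intro m hm
    have h := (Nat.modEq_iff_dvd.1 (Finset.mem_filter.1 hm).2)
    rw [Int.mul_ediv_cancel' h, sub_add_cancel]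
  have hq0 : (0 : ℚ) < q := by exact_mod_cast hq
  calc ∑ m ∈ (Finset.Icc n (q * n)).filter (fun m => r ≡ m [MOD q]), f m
      = ∑ m ∈ (Finset.Icc n (q * n)).filter (fun m => r ≡ m [MOD q]), f (q * κ m + r).toNat :=
        Finset.sum_congr rfl fun m hm => by rw [hκ m hm, Int.toNat_natCast]
    _ = ∑ k ∈ ((Finset.Icc n (q * n)).filter (fun m => r ≡ m [MOD q])).image κ,
          f (q * k + r).toNat := by
        rw [Finset.sum_image]
        intro m hm m' hm' h
        have h1 := hκ m hm
        have h2 := hκ m' hm'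
        rw [h, h2] at h1
        exact_mod_cast h1.symm
    _ ≤ _ := by
        refine Finset.sum_le_sum_of_subset fun k hk => ?_
        obtain ⟨m, hm, rfl⟩ := Finset.mem_image.1 hk
        have h1 : (q : ℚ) * (κ m : ℚ) + r = m := by exact_mod_cast hκ m hm
        obtain ⟨h2, h3⟩ := Finset.mem_Icc.1 (Finset.mem_filter.1 hm).1
        have h2' : (n : ℚ) ≤ m := by exact_mod_cast h2
        have h3' : (m : ℚ) ≤ q * n := by exact_mod_cast h3
        rw [Finset.mem_Icc, Int.ceil_le, Int.le_floor, div_le_iff₀ hq0]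
        refine ⟨by linarith, ?_⟩
        rw [le_sub_iff_add_le, ← mul_le_mul_iff_right₀ hq0, mul_add, mul_div_cancel₀ _ hq0.ne']
        linarith

/-- The two families of inequalities, for the graded pieces spanned by the classes of the elements
of `S`. -/
theorem relRank_eigRank_inequalities [IsDomain A] [IsNoetherianRing A] (hA : IsCoeffRing p A)
    (hq : q.Prime) (hqp : q ∣ p - 1)
    (hΔ : ∀ δ ∈ Δ, Continuous δ) {δ₀ : Δ} (hgen : ∀ δ : Δ, ∃ i : ℕ, δ = δ₀ ^ i) (hδ : δ₀ ^ q = 1)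
    {χ₀ : Δ →* ℤ_[p]ˣ} (hχ₀ : χ₀ ≠ 1) {y : J → G} (hy : TopGenerates y)
    {ch : J → (Δ →* ℤ_[p]ˣ)}
    (hdiag : ∀ j, IsPadicPow (y j) (ch j δ₀ : ℤ_[p]) ((δ₀ : MulAut G) (y j)))
    (S : Set (Al A G)) (hS : ∀ s ∈ S, Al.act A hΔ δ₀ s ∈ S)
    (hmem : ∀ m j, ∀ v ∈ Submodule.span A (S ∩ (AlFil A G j ∩
        wtFil A y (fun j => psi χ₀ (ch j)) m)),
      ∃ s ∈ S, s ∈ AlFil A G j ∧ s ∈ wtFil A y (fun j => psi χ₀ (ch j)) m ∧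
        v - s ∈ AlFil A G (j + 1) ∧ v - s ∈ wtFil A y (fun j => psi χ₀ (ch j)) (m + 1))
    (r : ℕ → ℕ) (hr : ∀ m, r m = relRank
      (Submodule.span A (S ∩ (wtFil A y (fun j => psi χ₀ (ch j)) m : Set (Al A G))))
      (wtFil A y (fun j => psi χ₀ (ch j)) (m + 1)))
    (e : (Δ →* ℤ_[p]ˣ) → ℕ → ℕ) (he : ∀ χ n, e χ n = Module.finrank A
      ↥((Submodule.span A (S ∩ (AlFil A G n : Set (Al A G)))).map (AlFil A G (n + 1)).mkQ ⊓
        eig A Δ hΔ χ (n + 1))) :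
    (∀ n i : ℕ, r (q * n + i) ≤ ∑ j ∈ Finset.Icc n (q * n + i), e (χ₀ ^ i) j) ∧
    ∀ (n : ℕ) (χ : Δ →* ℤ_[p]ˣ), e χ n ≤
      ∑ k ∈ Finset.Icc ⌈((n : ℚ) - psi χ₀ χ) / q⌉ ⌊(n : ℚ) - psi χ₀ χ / q⌋,
        r (q * k + psi χ₀ χ).toNat := by
  obtain ⟨B, hBr, hBe⟩ : ∃ B : EigenBifiltration A (Al A G) q,
      (∀ m, relRank (B.sp m 0) (B.Q (m + 1)) = r m) ∧
      ∀ i n, B.eigRank i 0 n = e (χ₀ ^ i) n := by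
    refine ⟨alBifiltration hA hq hqp hΔ hgen hδ hχ₀ hy hdiag S hS hmem, fun m => ?_,
      fun i n => ?_⟩
    · have h : S ∩ (wtFil A y (fun j => psi χ₀ (ch j)) m : Set (Al A G)) =
          S ∩ ((AlFil A G 0 : Set (Al A G)) ∩ wtFil A y (fun j => psi χ₀ (ch j)) m) := by
        rw [AlFil_zero, Submodule.top_coe, Set.univ_inter]
      rw [hr, h]
      rfl
    · have h : S ∩ (AlFil A G n : Set (Al A G)) =
          S ∩ (AlFil A G n ∩ (wtFil A y (fun j => psi χ₀ (ch j)) 0 : Set (Al A G))) := by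
        rw [wtFil_zero, Submodule.top_coe, Set.inter_univ]
      rw [he, h, eig_eq_eigenspace hΔ hgen, MonoidHom.pow_apply, Units.val_pow_eq_pow_val,
        map_pow]
      rfl
  refine ⟨fun n i => ?_, fun n χ => ?_⟩
  · rw [← hBr]
    refine (B.relRank_Q_le_sum n i (B.Q_le_P_add hq.one_le n i)).trans
      (Finset.sum_le_sum fun j _ => ?_)
    rw [← hBe, EigenBifiltration.eigRank, EigenBifiltration.eigRank, pow_add, pow_mul, B.ζ_pow,
      one_pow, one_mul]
  · refine le_trans ?_ (sum_modEq_le_sum_Icc hq.one_le r n (psi χ₀ χ))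
    conv_lhs => rw [← (psi_spec hq hgen hδ hχ₀ χ).2.2]
    rw [← hBe]
    refine (B.eigRank_le_sum_relRank _ n).trans (Finset.sum_le_sum fun m _ => ?_)
    rw [hBr]

end Assembly

end Gocha

end

theorem mainTheorem10 (p q : ℕ) [Fact p.Prime] (hp : p ≠ 2) (hq : q.Prime) (hqp : q ∣ p - 1)
    -- the coefficient ring is `𝔽_p` or `ℤ_p`
    (A : Type*) [CommRing A] [Algebra ℤ_[p] A]
    (hA : Nonempty (A ≃+* ZMod p) ∨ Nonempty (A ≃+* ℤ_[p]))
    -- the pro-`p` group `G`, and the cyclic group `Δ` of order `q` of automorphisms of `G`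
    (G : Type*) [Group G] [TopologicalSpace G] [IsTopologicalGroup G] [CompactSpace G] [T2Space G]
    [TotallyDisconnectedSpace G] (hG : Gocha.IsProP p G)
    (Δ : Subgroup (MulAut G)) (hΔ : ∀ δ ∈ Δ, Continuous δ) (hcard : Nat.card Δ = q)
    -- the presentation `1 → R → F → G → 1`, with `F` free pro-`p` on the finite family `x`
    (F : Type*) [Group F] [TopologicalSpace F] [IsTopologicalGroup F] [CompactSpace F] [T2Space F]
    [TotallyDisconnectedSpace F] (hF : Gocha.IsProP p F)
    (J : Type*) [Finite J] (x : J → F) (hfree : Gocha.IsFreeProP p x)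
    (π : F →* G) (hπ : Continuous π) (hsurj : Function.Surjective π)
    -- the family `x` lifts bases of the eigenspaces of `𝓛_1(A, G)`, and `Δ` acts diagonally on it
    (ch : J → (Δ →* ℤ_[p]ˣ))
    (hbasis : Gocha.LiftsEigenbasis A Δ hΔ (fun j => π (x j)) ch)
    (hdiag : ∀ (δ : Δ) (j : J),
      Gocha.IsPadicPow (π (x j)) (ch j δ : ℤ_[p]) ((δ : MulAut G) (π (x j))))
    -- the fixed non-trivial character
    (χ₀ : Δ →* ℤ_[p]ˣ) (hχ₀ : χ₀ ≠ 1)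
    -- `𝓛(A, G)` and `𝓛_{χ₀}(A, G)` are torsion-free
    (htf : ∀ n, Module.IsTorsionFree A ↥(Gocha.calL A G n))
    (htfχ : ∀ n, Module.IsTorsionFree A
      ↥(Gocha.chiL p A x (fun j => Gocha.psi χ₀ (ch j)) π n)) :
    (∀ n i : ℕ,
      Gocha.cChi p A x (fun j => Gocha.psi χ₀ (ch j)) π (q * n + i) ≤
        ∑ j ∈ Finset.Icc n (q * n + i), Gocha.cEig A Δ hΔ (χ₀ ^ i) j ∧
      Gocha.aChi p A x (fun j => Gocha.psi χ₀ (ch j)) π (q * n + i) ≤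
        ∑ j ∈ Finset.Icc n (q * n + i), Gocha.aEig A Δ hΔ (χ₀ ^ i) j) ∧
    (∀ (n : ℕ) (χ : Δ →* ℤ_[p]ˣ),
      Gocha.cEig A Δ hΔ χ n ≤
        ∑ k ∈ Finset.Icc ⌈((n : ℚ) - Gocha.psi χ₀ χ) / q⌉ ⌊(n : ℚ) - Gocha.psi χ₀ χ / q⌋,
          Gocha.cChi p A x (fun j => Gocha.psi χ₀ (ch j)) π (q * k + Gocha.psi χ₀ χ).toNat ∧
      Gocha.aEig A Δ hΔ χ n ≤
        ∑ k ∈ Finset.Icc ⌈((n : ℚ) - Gocha.psi χ₀ χ) / q⌉ ⌊(n : ℚ) - Gocha.psi χ₀ χ / q⌋,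
          Gocha.aChi p A x (fun j => Gocha.psi χ₀ (ch j)) π (q * k + Gocha.psi χ₀ χ).toNat) := by
  classical
  have hA' : Gocha.IsCoeffRing p A := hA.elim
    (fun ⟨e⟩ => Gocha.isCoeffRing_zmod.of_ringEquiv e)
    (fun ⟨e⟩ => Gocha.isCoeffRing_padicInt.of_ringEquiv e)
  have := hA'.isDomain
  have := hA'.isNoetherianRing
  obtain ⟨δ₀, hgen, hδ⟩ : ∃ δ₀ : Δ, (∀ δ : Δ, ∃ i : ℕ, δ = δ₀ ^ i) ∧ δ₀ ^ q = 1 := by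
    have := Fact.mk hq
    have : IsCyclic Δ := isCyclic_of_prime_card hcard
    have : Finite Δ := Nat.finite_of_card_ne_zero (hcard ▸ hq.ne_zero)
    obtain ⟨δ₀, h⟩ := IsCyclic.exists_generator (α := Δ)
    refine ⟨δ₀, fun δ => ?_, by rw [← hcard, pow_card_eq_one']⟩
    obtain ⟨i, hi⟩ := (mem_powers_iff_mem_zpowers.2 (h δ))
    exact ⟨i, hi.symm⟩
  have hx := hfree.topGenerates hF
  have hy := hx.map π hπ hsurj
  have hwt : ∀ j, 1 ≤ Gocha.psi χ₀ (ch j) := fun j =>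
    (Gocha.psi_spec hq hgen hδ hχ₀ (ch j)).1
  obtain ⟨hc₁, hc₂⟩ := Gocha.relRank_eigRank_inequalities hA' hq hqp hΔ hgen hδ hχ₀ hy
    (fun j => hdiag δ₀ j) Set.univ (fun _ _ => Set.mem_univ _)
    (fun m j v hv => by
      rw [Set.univ_inter, ← Submodule.coe_inf, Submodule.span_eq] at hv
      exact ⟨v, Set.mem_univ v, hv.1, hv.2, by rw [sub_self]; exact Submodule.zero_mem _,
        by rw [sub_self]; exact Submodule.zero_mem _⟩)
    (Gocha.cChi p A x (fun j => Gocha.psi χ₀ (ch j)) π)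
    (fun m => by
      rw [Gocha.cChi_eq_relRank hA' hF hG hx hwt hπ hsurj, Set.univ_inter, Submodule.span_eq])
    (Gocha.cEig A Δ hΔ)
    (fun χ n => by
      rw [Set.univ_inter, Submodule.span_eq]
      rfl)
  obtain ⟨ha₁, ha₂⟩ := Gocha.relRank_eigRank_inequalities hA' hq hqp hΔ hgen hδ hχ₀ hy
    (fun j => hdiag δ₀ j) (Gocha.grpSet A G)
    (by
      rintro _ ⟨g, rfl⟩
      exact ⟨(δ₀ : MulAut G) g, by rw [map_sub, Gocha.Al.act_of, map_one]⟩)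
    (Gocha.exists_mem_grpSet hA' hy hwt)
    (Gocha.aChi p A x (fun j => Gocha.psi χ₀ (ch j)) π)
    (Gocha.aChi_eq_relRank hA' hF hG hx hwt hπ hsurj)
    (Gocha.aEig A Δ hΔ)
    (fun χ n => by
      have h : Gocha.grpSet A G ∩ (Gocha.AlFil A G n : Set (Gocha.Al A G)) =
          {v | ∃ g ∈ Gocha.grp (G := G) A n, v = Gocha.Al.of A g - 1} := by
        ext v
        constructor
        · rintro ⟨⟨g, rfl⟩, hv⟩
          exact ⟨g, hv, rfl⟩
        · rintro ⟨g, hg, rfl⟩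
          exact ⟨⟨g, rfl⟩, hg⟩
      rw [h, Submodule.map_span]
      rfl)
  exact ⟨fun n i => ⟨hc₁ n i, ha₁ n i⟩, fun n χ => ⟨hc₂ n χ, ha₂ n χ⟩⟩
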